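/- Let $K$ be a field of characteristic zero; tensor products are over $K$, $'$ denotes the $K$-dual. **Dialgebras.** A dialgebra $D$ is a $K$-vector space with bilinear products $\dashv,\vdash$ such that $x\dashv(y\dashv z)=(x\dashv y)\dashv z=x\dashv(y\vdash z)$, $(x\vdash y)\dashv z=x\vdash(y\dashv z)$, $(x\dashv y)\vdash z=x\vdash(y\vdash z)=(x\vdash y)\vdash z$. Let $Y_n$ be the set of planar binary trees with $n$ vertices (leaves numbered $0,\dots,n$ from left to right), $d_i:Y_n\to Y_{n-1}$ the deletion of the $i$-th leaf, and $|\in Y_0$ the trivial tree. For $y\in Y_{n+1}$ put $\circ_0^y=\dashv$ if $y=|\vee y_1$ and $\vdash$ otherwise; $\circ_{n+1}^y=\vdash$ if $y=y_1\vee|$ and $\dashv$ otherwise; and for $1\le i\le n$, $\circ_i^y=\dashv$ if the $i$-th leaf is a left child (oriented like $\backslash$), and $\vdash$ if it is a right child. Let $HY^*(D,D)$ be the cohomology of $CY^n(D,D)=\mathrm{Hom}(K[Y_n]\otimes D^{\otimes n},D)$, with $$(\delta f)(y;a_1,\dots,a_{n+1})=a_1\circ_0^yf(d_0y;a_2,\dots,a_{n+1})+\sum_{i=1}^n(-1)^if(d_iy;a_1,\dots,a_i\circ_i^ya_{i+1},\dots,a_{n+1})+(-1)^{n+1}f(d_{n+1}y;a_1,\dots,a_n)\circ_{n+1}^ya_{n+1}.$$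 **Deformations.** Let $A$ be a commutative unital $K$-algebra with augmentation $\epsilon:A\to K$. A deformation of $D$ with base $A$ is an $A$-dialgebra structure on $A\otimes D$ for which $\epsilon\otimes\mathrm{id}:A\otimes D\to D$ is a dialgebra morphism. Two deformations with base $A$ are equivalent if there is an $A$-linear dialgebra isomorphism between them compatible with $\epsilon\otimes\mathrm{id}$. For a homomorphism $\phi:A\to A_1$ of augmented algebras, the push-out $\phi_*\lambda$ is the deformation with base $A_1$ whose products are the $A_1$-bilinear ones with $(1\otimes x)*_{\phi_*\lambda}(1\otimes y)=(\phi\otimes\mathrm{id})\big((1\otimes x)*_\lambda(1\otimes y)\big)$. **Harrison extensions.** Let $A$ act on a vector space $V$ through $\epsilon$. A Harrison 2-cocycle is a symmetric bilinear map $f:A\times A\to V$ with $a f(b,c)-f(ab,c)+f(a,bc)-c f(a,b)=0$; coboundaries are the maps $(a,b)\mapsto a\,h(b)-h(ab)+b\,h(a)$ with $h:A\to V$ linear; $H^2_{Harr}(A;V)$ is the quotient. A cocycle $f$ defines an extension $0\to V\to B\to A\to0$, where $B=A\oplus V$ with $(a,v)(b,w)=(ab,\,aw+bv+f(a,b))$,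 augmented through $A$. **Obstruction map.** Let $\lambda$ be a deformation of $D$ with base $A$, let $f$ be a Harrison cocycle with values in $K$, and let $0\to K\to B\to A\to0$ be its extension, with linear splitting $q:A\to B$, $q(a)=(a,0)$. Let $\{\,,\}_*$, $*\in\{\dashv,\vdash\}$, be the $B$-bilinear products on $B\otimes D$ with $\{1\otimes x,1\otimes y\}_*=(q\otimes\mathrm{id})\big((1\otimes x)*_\lambda(1\otimes y)\big)$. For $y\in Y_3$ the element $$\{1\otimes a,\{1\otimes b,1\otimes c\}_{\circ_2^y}\}_{\circ_0^y}-\{\{1\otimes a,1\otimes b\}_{\circ_1^y},1\otimes c\}_{\circ_3^y}$$ lies in $K\otimes D=D$. This defines a $3$-cocycle of $D$, and sending $[f]$ to its class gives a well-defined linear map $\mathbb O_\lambda:H^2_{Harr}(A;K)\to HY^3(D,D)$. **Construction.** Let $D$ be a dialgebra with $\dim HY^2(D,D)<\infty$. Let $C_1=K\oplus HY^2(D,D)'$, where $HY^2(D,D)'$ is an ideal of square zero, with augmentation the projection to $K$. Choose a linear map $\mu_0$ from $HY^2(D,D)$ to the $2$-cocycles which sends each class to a representative. Let $\eta_1$ be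 the deformation with base $C_1$ whose products on $C_1\otimes D=D\oplus\mathrm{Hom}(HY^2(D,D),D)$ are the $C_1$-bilinear ones with $x*x'=\big(x*x',\ \alpha\mapsto\mu_0(\alpha)(y_*;x,x')\big)$ for $x,x'\in D$, where $y_\dashv=|\vee(|\vee|)$ and $y_\vdash=(|\vee|)\vee|$. Given, for some $k\ge1$, the algebra $C_k$ and the deformation $\eta_k$ with base $C_k$, choose a linear map $\mu$ from $H^2_{Harr}(C_k;K)$ to the Harrison cocycles which sends each class to a representative. Let $0\to H^2_{Harr}(C_k;K)'\xrightarrow{\bar i_{k+1}}\overline C_{k+1}\to C_k\to0$ be the extension defined by the cocycle $(a,b)\mapsto(\alpha\mapsto\mu(\alpha)(a,b))$. Let $\omega_k=\mathbb O_{\eta_k}:H^2_{Harr}(C_k;K)\to HY^3(D,D)$, with dual $\omega_k'$, and put $C_{k+1}=\overline C_{k+1}/\bar i_{k+1}(\omega_k'(HY^3(D,D)'))$. Let $p_{k+1}:C_{k+1}\to C_k$ be induced by the projection of $\overline C_{k+1}$, and $i_{k+1}:(\ker\omega_k)'\cong\mathrm{coker}(\omega_k')\to C_{k+1}$ by $\bar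 i_{k+1}$; the augmentation of $C_{k+1}$ is that of $C_k$ composed with $p_{k+1}$. The construction is continued with $C_{k+1}$ and any deformation $\eta_{k+1}$ with base $C_{k+1}$ such that $(p_{k+1})_*\eta_{k+1}=\eta_k$. **Proposition.** Let $k\ge1$, let $(C_k,\eta_k)$ be obtained in this way with any choices made at the earlier stages, and let $C_{k+1}$ be formed with any $\mu$ as above. Then: 1. $C_{k+1}$ is a finite dimensional local algebra, and $$0\to(\ker\omega_k)'\xrightarrow{\,i_{k+1}\,}C_{k+1}\xrightarrow{\,p_{k+1}\,}C_k\to0$$ is exact. 2. The deformation $\eta_k$ extends to $C_{k+1}$: there is a deformation $\eta_{k+1}$ of $D$ with base $C_{k+1}$ such that $(p_{k+1})_*\eta_{k+1}=\eta_k$. 3. The extension is unique up to an isomorphism and an automorphism of the extension in 1: if $\eta',\eta''$ are deformations with base $C_{k+1}$ and $(p_{k+1})_*\eta'=(p_{k+1})_*\eta''=\eta_k$, there is a $K$-algebra automorphism $r$ of $C_{k+1}$ with $r\circ i_{k+1}=i_{k+1}$ and $p_{k+1}\circ r=p_{k+1}$ such that $r_*\eta'$ is equivalent to $\eta''$. 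-/

import Mathlib

set_option maxSynthPendingDepth 3

open scoped TensorProduct

universe u v w

noncomputable section

namespace DialgDef

/-! ## Planar binary trees -/

/-- The two dialgebra products: `left` is `⊣`, `right` is `⊢`. -/
inductive Side
  | left
  | right
  deriving DecidableEq

/-- Planar binary trees (the one-leaf tree `|` is `nil`, grafting is `node ()`). -/
abbrev PBT : Type := BinaryTree Unit

namespace PBT

/-- The tree obtained by deleting the `i`-th leaf, the leaves being numbered `0, 1, …` from left to
right. -/
def deleteLeaf : PBT → ℕ → PBT
  | .nil, _ => .nil
  | .node _ s t, i =>
    if i ≤ s.numNodes then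
      (if s = .nil then t else .node () (deleteLeaf s i) t)
    else
      (if t = .nil then s else .node () s (deleteLeaf t (i - (s.numNodes + 1))))

/-- The product attached to the `i`-th leaf by its orientation: `⊣` if the leaf is oriented like
`\`, i.e. it is a left child, and `⊢` if it is oriented like `/`, i.e. it is a right child. -/
def leafSide : PBT → ℕ → Side
  | .nil, _ => .left
  | .node _ s t, i =>
    if i ≤ s.numNodes then
      (if s = .nil then .left else leafSide s i)
    else
      (if t = .nil then .right else leafSide t (i - (s.numNodes + 1)))

/-- `∘_0`: it is `⊣` if the tree is of the form `| ∨ t`, and `⊢` otherwise. -/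
def firstSide : PBT → Side
  | .nil => .right
  | .node _ s _ => if s = .nil then .left else .right

/-- `∘_{n}` for an `n`-tree: it is `⊢` if the tree is of the form `s ∨ |`, and `⊣` otherwise. -/
def lastSide : PBT → Side
  | .nil => .left
  | .node _ _ t => if t = .nil then .right else .left

theorem numNodes_deleteLeaf :
    ∀ (t : PBT) (i : ℕ), i ≤ t.numNodes → (deleteLeaf t i).numNodes = t.numNodes - 1
  | .nil, _, _ => rfl
  | .node _ s t, i, h => by
    have hs := numNodes_deleteLeaf s i
    have ht := numNodes_deleteLeaf t (i - (s.numNodes + 1))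
    simp only [BinaryTree.numNodes] at h
    rw [deleteLeaf]
    have key : ∀ r : PBT, r ≠ .nil → 1 ≤ r.numNodes := by
      intro r hr
      cases r with
      | nil => exact absurd rfl hr
      | node _ a b => simp [BinaryTree.numNodes]
    split_ifs with h1 h2 h3
    · subst h2; simp [BinaryTree.numNodes]
    · have := key s h2
      simp only [BinaryTree.numNodes]
      have := hs h1
      omega
    · subst h3; simp [BinaryTree.numNodes]
    · have := key t h3
      simp only [BinaryTree.numNodes]
      have := ht (by omega)
      omega

end PBT

/-- `Y n` is the set of planar binary trees with `n` vertices. -/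
def Y (n : ℕ) : Type := {t : PBT // t.numNodes = n}

/-- The face map `d_i : Y_{n+1} → Y_n`, deleting the `i`-th leaf, `0 ≤ i ≤ n + 1`. -/
def face {n : ℕ} (i : Fin (n + 2)) (y : Y (n + 1)) : Y n :=
  ⟨PBT.deleteLeaf y.1 i, by
    rw [PBT.numNodes_deleteLeaf _ _ (by rw [y.2]; omega), y.2, Nat.add_sub_cancel]⟩

/-- The product `∘_i^y ∈ {⊣, ⊢}` for `y ∈ Y_{n+1}` and `0 ≤ i ≤ n + 1`. -/
def circ {n : ℕ} (i : Fin (n + 2)) (y : Y (n + 1)) : Side :=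
  if i = 0 then PBT.firstSide y.1
  else if i = Fin.last (n + 1) then PBT.lastSide y.1
  else PBT.leafSide y.1 i

/-- The label of a `2`-tree: `[21] = | ∨ (| ∨ |)` corresponds to `⊣` and `[12] = (| ∨ |) ∨ |`
to `⊢`. -/
def prodSide (y : Y 2) : Side := circ 0 y

theorem exists_of_numNodes_succ {n : ℕ} (t : PBT) (h : t.numNodes = n + 1) :
    ∃ a b : PBT, t = .node () a b ∧ a.numNodes + b.numNodes = n := by
  cases t with
  | nil => simp at h
  | node x a b => exact ⟨a, b, rfl, by simpa [BinaryTree.numNodes] using h⟩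

theorem eq_nil_of_numNodes (t : PBT) (h : t.numNodes = 0) : t = .nil := by
  cases t with
  | nil => rfl
  | node x a b => simp at h

theorem tree_one (t : PBT) (h : t.numNodes = 1) : t = .node () .nil .nil := by
  obtain ⟨a, b, rfl, hab⟩ := exists_of_numNodes_succ t h
  rw [eq_nil_of_numNodes a (by omega), eq_nil_of_numNodes b (by omega)]

/-- The two `2`-trees. -/
def trees2 : List PBT :=
  [.node () .nil (.node () .nil .nil), .node () (.node () .nil .nil) .nil]

/-- The five `3`-trees. -/
def trees3 : List PBT :=
  trees2.map (fun t => .node () .nil t) ++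
    [.node () (.node () .nil .nil) (.node () .nil .nil)] ++
    trees2.map (fun t => .node () t .nil)

/-- The fourteen `4`-trees. -/
def trees4 : List PBT :=
  trees3.map (fun t => .node () .nil t) ++
    trees2.map (fun t => .node () (.node () .nil .nil) t) ++
    trees2.map (fun t => .node () t (.node () .nil .nil)) ++
    trees3.map (fun t => .node () t .nil)

theorem mem_trees2 (t : PBT) (h : t.numNodes = 2) : t ∈ trees2 := by
  obtain ⟨a, b, rfl, hab⟩ := exists_of_numNodes_succ t h
  obtain h1 | h1 : a.numNodes = 0 ∨ a.numNodes = 1 := by omega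
  · rw [eq_nil_of_numNodes a h1, tree_one b (by omega)]; simp [trees2]
  · rw [tree_one a h1, eq_nil_of_numNodes b (by omega)]; simp [trees2]

theorem mem_trees3 (t : PBT) (h : t.numNodes = 3) : t ∈ trees3 := by
  obtain ⟨a, b, rfl, hab⟩ := exists_of_numNodes_succ t h
  obtain h1 | h1 | h1 : a.numNodes = 0 ∨ a.numNodes = 1 ∨ a.numNodes = 2 := by omega
  · rw [eq_nil_of_numNodes a h1, trees3]
    have := mem_trees2 b (by omega)
    exact List.mem_append_left _ (List.mem_append_left _ (List.mem_map_of_mem this))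
  · rw [tree_one a h1, tree_one b (by omega)]; simp [trees3]
  · rw [eq_nil_of_numNodes b (by omega), trees3]
    have := mem_trees2 a h1
    exact List.mem_append_right _ (List.mem_map_of_mem this)

theorem mem_trees4 (t : PBT) (h : t.numNodes = 4) : t ∈ trees4 := by
  obtain ⟨a, b, rfl, hab⟩ := exists_of_numNodes_succ t h
  obtain h1 | h1 | h1 | h1 : a.numNodes = 0 ∨ a.numNodes = 1 ∨ a.numNodes = 2 ∨
    a.numNodes = 3 := by omega
  · rw [eq_nil_of_numNodes a h1, trees4]
    have := mem_trees3 b (by omega)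
    exact List.mem_append_left _ (List.mem_append_left _
      (List.mem_append_left _ (List.mem_map_of_mem this)))
  · rw [tree_one a h1, trees4]
    have := mem_trees2 b (by omega)
    exact List.mem_append_left _ (List.mem_append_left _
      (List.mem_append_right _ (List.mem_map_of_mem this)))
  · rw [tree_one b (by omega), trees4]
    have := mem_trees2 a h1
    exact List.mem_append_left _ (List.mem_append_right _ (List.mem_map_of_mem this))
  · rw [eq_nil_of_numNodes b (by omega), trees4]
    have := mem_trees3 a h1
    exact List.mem_append_right _ (List.mem_map_of_mem this)

/-- The relations between the faces of a `3`-tree and its four products. -/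
theorem prodSide_face (y : Y 3) :
    prodSide (face 0 y) = circ 2 y ∧ prodSide (face 1 y) = circ 3 y ∧
      prodSide (face 2 y) = circ 0 y ∧ prodSide (face 3 y) = circ 1 y := by
  obtain ⟨t, ht⟩ := y
  have key : ∀ t ∈ trees3, ∀ h : t.numNodes = 3,
      prodSide (face 0 ⟨t, h⟩) = circ 2 (⟨t, h⟩ : Y 3) ∧
      prodSide (face 1 ⟨t, h⟩) = circ 3 (⟨t, h⟩ : Y 3) ∧
      prodSide (face 2 ⟨t, h⟩) = circ 0 (⟨t, h⟩ : Y 3) ∧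
      prodSide (face 3 ⟨t, h⟩) = circ 1 (⟨t, h⟩ : Y 3) := by decide
  exact key t (mem_trees3 t ht) ht

/-- The relations between the products of a `4`-tree and those of its faces. -/
theorem circ_face (y : Y 4) :
    (circ 0 y = circ 0 (face 3 y) ∧ circ 0 (face 0 y) = circ 2 (face 3 y) ∧
      circ 2 (face 0 y) = circ 3 y) ∧
    (circ 0 y = circ 0 (face 2 y) ∧ circ 3 (face 0 y) = circ 2 (face 2 y) ∧
      circ 1 (face 0 y) = circ 2 y) ∧
    (circ 0 (face 1 y) = circ 3 (face 3 y) ∧ circ 2 (face 1 y) = circ 3 y ∧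
      circ 1 y = circ 1 (face 3 y)) ∧
    (circ 3 (face 1 y) = circ 4 y ∧ circ 1 (face 1 y) = circ 3 (face 4 y) ∧
      circ 1 y = circ 1 (face 4 y)) ∧
    (circ 3 (face 2 y) = circ 4 y ∧ circ 1 (face 2 y) = circ 0 (face 4 y) ∧
      circ 2 y = circ 2 (face 4 y)) := by
  obtain ⟨t, ht⟩ := y
  have key : ∀ t ∈ trees4, ∀ h : t.numNodes = 4, ∀ y : Y 4, y = ⟨t, h⟩ →
    (circ 0 y = circ 0 (face 3 y) ∧ circ 0 (face 0 y) = circ 2 (face 3 y) ∧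
      circ 2 (face 0 y) = circ 3 y) ∧
    (circ 0 y = circ 0 (face 2 y) ∧ circ 3 (face 0 y) = circ 2 (face 2 y) ∧
      circ 1 (face 0 y) = circ 2 y) ∧
    (circ 0 (face 1 y) = circ 3 (face 3 y) ∧ circ 2 (face 1 y) = circ 3 y ∧
      circ 1 y = circ 1 (face 3 y)) ∧
    (circ 3 (face 1 y) = circ 4 y ∧ circ 1 (face 1 y) = circ 3 (face 4 y) ∧
      circ 1 y = circ 1 (face 4 y)) ∧
    (circ 3 (face 2 y) = circ 4 y ∧ circ 1 (face 2 y) = circ 0 (face 4 y) ∧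
      circ 2 y = circ 2 (face 4 y)) := by
    intro t ht h y hy
    subst hy
    revert h
    revert t
    decide
  exact key t (mem_trees4 t ht) ht _ rfl

/-! ## Dialgebras and their cohomology in degrees two and three -/

/-- A dialgebra structure on an `R`-module `M`: two `R`-bilinear products `⊣` (`left`) and `⊢`
(`right`) satisfying the five dialgebra axioms. -/
@[ext]
structure Dialgebra (R : Type*) (M : Type*) [CommRing R] [AddCommGroup M] [Module R M] where
  left : M →ₗ[R] M →ₗ[R] M
  right : M →ₗ[R] M →ₗ[R] M
  left_left : ∀ x y z, left x (left y z) = left (left x y) z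
  left_right : ∀ x y z, left (left x y) z = left x (right y z)
  inner_assoc : ∀ x y z, left (right x y) z = right x (left y z)
  right_left : ∀ x y z, right (left x y) z = right x (right y z)
  right_right : ∀ x y z, right x (right y z) = right (right x y) z

/-- The product of a dialgebra with a given label. -/
def Dialgebra.op {R : Type*} {M : Type*} [CommRing R] [AddCommGroup M] [Module R M]
    (S : Dialgebra R M) : Side → M →ₗ[R] M →ₗ[R] M
  | .left => S.left
  | .right => S.right

section Trilinear

variable {R : Type*} {M : Type*} [CommRing R] [AddCommGroup M] [Module R M]

/-- The trilinear map `(a, b, c) ↦ g a (f b c)`. -/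
def compRight (g f : M →ₗ[R] M →ₗ[R] M) : M →ₗ[R] M →ₗ[R] M →ₗ[R] M where
  toFun a := f.compr₂ (g a)
  map_add' a b := by ext; simp
  map_smul' r a := by ext; simp

/-- The trilinear map `(a, b, c) ↦ g (f a b) c`. -/
def compLeft (g f : M →ₗ[R] M →ₗ[R] M) : M →ₗ[R] M →ₗ[R] M →ₗ[R] M := f.compr₂ g

@[simp] theorem compRight_apply (g f : M →ₗ[R] M →ₗ[R] M) (a b c : M) :
    compRight g f a b c = g a (f b c) := rfl

@[simp] theorem compLeft_apply (g f : M →ₗ[R] M →ₗ[R] M) (a b c : M) :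
    compLeft g f a b c = g (f a b) c := rfl

/-- The defect of the dialgebra axiom belonging to the `3`-tree `y`, for two arbitrary bilinear
products: `(a, b, c) ↦ a ∘_0 (b ∘_2 c) - (a ∘_1 b) ∘_3 c`. -/
def axiomDefect (m : Side → M →ₗ[R] M →ₗ[R] M) (y : Y 3) : M →ₗ[R] M →ₗ[R] M →ₗ[R] M :=
  compRight (m (circ 0 y)) (m (circ 2 y)) - compLeft (m (circ 3 y)) (m (circ 1 y))

theorem axiomDefect_apply (m : Side → M →ₗ[R] M →ₗ[R] M) (y : Y 3) (a b c : M) :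
    axiomDefect m y a b c =
      m (circ 0 y) a (m (circ 2 y) b c) - m (circ 3 y) (m (circ 1 y) a b) c := rfl

theorem Dialgebra.axiomDefect_eq_zero (S : Dialgebra R M) (y : Y 3) : axiomDefect S.op y = 0 := by
  ext a b c
  rw [axiomDefect_apply]
  have key : ∀ t ∈ trees3, ∀ h : t.numNodes = 3,
      (circ 0 (⟨t, h⟩ : Y 3), circ 1 (⟨t, h⟩ : Y 3), circ 2 (⟨t, h⟩ : Y 3), circ 3 (⟨t, h⟩ : Y 3)) ∈
      [(Side.left, Side.left, Side.left, Side.left), (.left, .left, .right, .left),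
        (.right, .right, .left, .left), (.right, .left, .right, .right),
        (.right, .right, .right, .right)] := by decide
  have h := key y.1 (mem_trees3 y.1 y.2) y.2
  have hy : (⟨y.1, y.2⟩ : Y 3) = y := rfl
  simp only [hy, List.mem_cons, Prod.mk.injEq, List.not_mem_nil, or_false] at h
  rcases h with ⟨h0, h1, h2, h3⟩ | ⟨h0, h1, h2, h3⟩ | ⟨h0, h1, h2, h3⟩ | ⟨h0, h1, h2, h3⟩ |
    ⟨h0, h1, h2, h3⟩ <;> rw [h0, h1, h2, h3] <;> simp only [Dialgebra.op, LinearMap.zero_apply]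
  · rw [S.left_left, sub_self]
  · rw [S.left_right, sub_self]
  · rw [S.inner_assoc, sub_self]
  · rw [S.right_left, sub_self]
  · rw [S.right_right, sub_self]

/-- Two bilinear products all of whose axiom defects vanish form a dialgebra. -/
def Dialgebra.ofDefect (m : Side → M →ₗ[R] M →ₗ[R] M) (h : ∀ y, axiomDefect m y = 0) :
    Dialgebra R M where
  left := m .left
  right := m .right
  left_left a b c := by
    have := LinearMap.congr_fun (LinearMap.congr_fun (LinearMap.congr_fun
      (h ⟨.node () .nil (.node () .nil (.node () .nil .nil)), rfl⟩) a) b) c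
    exact sub_eq_zero.1 this
  left_right a b c := by
    have := LinearMap.congr_fun (LinearMap.congr_fun (LinearMap.congr_fun
      (h ⟨.node () .nil (.node () (.node () .nil .nil) .nil), rfl⟩) a) b) c
    exact (sub_eq_zero.1 this).symm
  inner_assoc a b c := by
    have := LinearMap.congr_fun (LinearMap.congr_fun (LinearMap.congr_fun
      (h ⟨.node () (.node () .nil .nil) (.node () .nil .nil), rfl⟩) a) b) c
    exact (sub_eq_zero.1 this).symm
  right_left a b c := by
    have := LinearMap.congr_fun (LinearMap.congr_fun (LinearMap.congr_fun
      (h ⟨.node () (.node () .nil (.node () .nil .nil)) .nil, rfl⟩) a) b) c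
    exact (sub_eq_zero.1 this).symm
  right_right a b c := by
    have := LinearMap.congr_fun (LinearMap.congr_fun (LinearMap.congr_fun
      (h ⟨.node () (.node () (.node () .nil .nil) .nil) .nil, rfl⟩) a) b) c
    exact sub_eq_zero.1 this

end Trilinear

section Quotient

variable {K : Type*} {V : Type w} [Field K] [AddCommGroup V] [Module K V]

/-- The quotient `Z / (B ∩ Z)` of two submodules of `V`: the cohomology with cocycles `Z` and
coboundaries `B`. -/
def Cohom (Z B : Submodule K V) : Type w := Z ⧸ B.submoduleOf Z

namespace Cohom

variable (Z B : Submodule K V)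

instance : AddCommGroup (Cohom Z B) := inferInstanceAs (AddCommGroup (Z ⧸ B.submoduleOf Z))

instance : Module K (Cohom Z B) := inferInstanceAs (Module K (Z ⧸ B.submoduleOf Z))

/-- The class of a cocycle. -/
def mk : Z →ₗ[K] Cohom Z B := (B.submoduleOf Z).mkQ

theorem mk_surjective : Function.Surjective (mk Z B) := (B.submoduleOf Z).mkQ_surjective

theorem mk_eq_zero_iff (z : Z) : mk Z B z = 0 ↔ z.1 ∈ B :=
  Submodule.Quotient.mk_eq_zero (B.submoduleOf Z)

variable {Z B}

/-- The linear map on cohomology induced by a linear map on cocycles vanishing on coboundaries. -/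
def lift {M : Type*} [AddCommGroup M] [Module K M] (g : Z →ₗ[K] M)
    (h : ∀ z : Z, z.1 ∈ B → g z = 0) : Cohom Z B →ₗ[K] M :=
  (B.submoduleOf Z).liftQ g h

theorem lift_mk {M : Type*} [AddCommGroup M] [Module K M] (g : Z →ₗ[K] M)
    (h : ∀ z : Z, z.1 ∈ B → g z = 0) (z : Z) : lift g h (mk Z B z) = g z := rfl

end Cohom

end Quotient

section Cohomology

variable {K : Type u} {D : Type v} [Field K] [AddCommGroup D] [Module K D]

variable (K D) in
/-- `CY^1(D, D) = Hom(K[Y_1] ⊗ D, D)`. -/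
abbrev CY1 : Type v := Y 1 → D →ₗ[K] D

variable (K D) in
/-- `CY^2(D, D) = Hom(K[Y_2] ⊗ D ⊗ D, D)`. -/
abbrev CY2 : Type v := Y 2 → D →ₗ[K] D →ₗ[K] D

variable (K D) in
/-- `CY^3(D, D) = Hom(K[Y_3] ⊗ D ⊗ D ⊗ D, D)`. -/
abbrev CY3 : Type v := Y 3 → D →ₗ[K] D →ₗ[K] D →ₗ[K] D

/-- The coboundary `δ : CY^1 → CY^2`. -/
def delta1 (S : Dialgebra K D) : CY1 K D →ₗ[K] CY2 K D where
  toFun f y := (S.op (circ 0 y)).compl₂ (f (face 0 y)) - (S.op (circ 1 y)).compr₂ (f (face 1 y)) +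
    (S.op (circ 2 y)).comp (f (face 2 y))
  map_add' f g := by
    funext y
    refine LinearMap.ext₂ fun a b => ?_
    simp
    abel
  map_smul' r f := by
    funext y
    refine LinearMap.ext₂ fun a b => ?_
    simp [smul_sub]

theorem delta1_apply (S : Dialgebra K D) (f : CY1 K D) (y : Y 2) (a b : D) :
    delta1 S f y a b = S.op (circ 0 y) a (f (face 0 y) b) - f (face 1 y) (S.op (circ 1 y) a b) +
      S.op (circ 2 y) (f (face 2 y) a) b := rfl

/-- The coboundary `δ : CY^2 → CY^3`. -/
def delta2 (S : Dialgebra K D) : CY2 K D →ₗ[K] CY3 K D where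
  toFun f y := compRight (S.op (circ 0 y)) (f (face 0 y)) -
    compLeft (f (face 1 y)) (S.op (circ 1 y)) + compRight (f (face 2 y)) (S.op (circ 2 y)) -
    compLeft (S.op (circ 3 y)) (f (face 3 y))
  map_add' f g := by
    funext y
    refine LinearMap.ext fun a => LinearMap.ext₂ fun b c => ?_
    simp
    abel
  map_smul' r f := by
    funext y
    refine LinearMap.ext fun a => LinearMap.ext₂ fun b c => ?_
    simp [smul_sub]

theorem delta2_apply (S : Dialgebra K D) (f : CY2 K D) (y : Y 3) (a b c : D) :
    delta2 S f y a b c = S.op (circ 0 y) a (f (face 0 y) b c) -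
      f (face 1 y) (S.op (circ 1 y) a b) c + f (face 2 y) a (S.op (circ 2 y) b c) -
      S.op (circ 3 y) (f (face 3 y) a b) c := rfl

/-- The coboundary `δ` on `CY^3`. Only its kernel is used, so its values are recorded as plain
functions of a `4`-tree and four arguments. -/
def delta3 (S : Dialgebra K D) : CY3 K D →ₗ[K] (Y 4 → D → D → D → D → D) where
  toFun f y a b c d := S.op (circ 0 y) a (f (face 0 y) b c d) -
    f (face 1 y) (S.op (circ 1 y) a b) c d + f (face 2 y) a (S.op (circ 2 y) b c) d -
    f (face 3 y) a b (S.op (circ 3 y) c d) + S.op (circ 4 y) (f (face 4 y) a b c) d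
  map_add' f g := by funext; simp; abel
  map_smul' r f := by funext; simp [smul_sub]

theorem delta3_apply (S : Dialgebra K D) (f : CY3 K D) (y : Y 4) (a b c d : D) :
    delta3 S f y a b c d = S.op (circ 0 y) a (f (face 0 y) b c d) -
      f (face 1 y) (S.op (circ 1 y) a b) c d + f (face 2 y) a (S.op (circ 2 y) b c) d -
      f (face 3 y) a b (S.op (circ 3 y) c d) + S.op (circ 4 y) (f (face 4 y) a b c) d := rfl

/-- The `2`-cocycles. -/
abbrev ZY2 (S : Dialgebra K D) : Submodule K (CY2 K D) := LinearMap.ker (delta2 S)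

/-- The `3`-cocycles. -/
abbrev ZY3 (S : Dialgebra K D) : Submodule K (CY3 K D) := LinearMap.ker (delta3 S)

/-- `HY^2(D, D)`. -/
abbrev HY2 (S : Dialgebra K D) : Type v := Cohom (ZY2 S) (LinearMap.range (delta1 S))

/-- `HY^3(D, D)`. -/
abbrev HY3 (S : Dialgebra K D) : Type v := Cohom (ZY3 S) (LinearMap.range (delta2 S))

/-- The class in `HY^2(D, D)` of a `2`-cocycle. -/
abbrev HY2.mk (S : Dialgebra K D) : ZY2 S →ₗ[K] HY2 S := Cohom.mk _ _

/-- The class in `HY^3(D, D)` of a `3`-cocycle. -/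
abbrev HY3.mk (S : Dialgebra K D) : ZY3 S →ₗ[K] HY3 S := Cohom.mk _ _

end Cohomology

/-! ## Deformations -/

section Deformations

variable {K : Type u} {D : Type v} [Field K] [AddCommGroup D] [Module K D]

/-- The map `h ⊗ id : A ⊗ D → K ⊗ D = D` for a linear form `h` on `A`. -/
def contract {A : Type w} [AddCommGroup A] [Module K A] (D : Type v) [AddCommGroup D] [Module K D]
    (h : A →ₗ[K] K) : A ⊗[K] D →ₗ[K] D :=
  (TensorProduct.lid K D).toLinearMap ∘ₗ h.rTensor D

@[simp] theorem contract_tmul {A : Type w} [AddCommGroup A] [Module K A]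
    (h : A →ₗ[K] K) (a : A) (x : D) : contract D h (a ⊗ₜ x) = h a • x := by
  simp [contract]

/-- The `A`-bilinear product on `A ⊗ D` which extends a `K`-bilinear map `D × D → A ⊗ D`. -/
def extendBilin {A : Type w} [CommRing A] [Algebra K A] (b : D →ₗ[K] D →ₗ[K] A ⊗[K] D) :
    A ⊗[K] D →ₗ[A] A ⊗[K] D →ₗ[A] A ⊗[K] D :=
  LinearMap.liftBaseChange A
    (((LinearMap.liftBaseChangeEquiv (M := D) (N := A ⊗[K] D) (R := K)
      A).toLinearMap.restrictScalars K) ∘ₗ b)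

theorem extendBilin_tmul {A : Type w} [CommRing A] [Algebra K A]
    (b : D →ₗ[K] D →ₗ[K] A ⊗[K] D) (s t : A) (x y : D) :
    extendBilin b (s ⊗ₜ x) (t ⊗ₜ y) = (s * t) • b x y := by
  simp [extendBilin, mul_smul]

/-- A deformation of the dialgebra `S` on `D` with base the commutative unital algebra `A`,
augmented by `ε`: an `A`-dialgebra structure on `A ⊗ D` such that the (automatically `A`-linear) map
`ε ⊗ id : A ⊗ D → K ⊗ D = D` is a morphism of dialgebras. -/
@[ext]
structure Deformation (S : Dialgebra K D) (A : Type w) [CommRing A] [Algebra K A] (ε : A →ₐ[K] K)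
    extends Dialgebra A (A ⊗[K] D) where
  aug_left : ∀ u v, contract D ε.toLinearMap (left u v) =
    S.left (contract D ε.toLinearMap u) (contract D ε.toLinearMap v)
  aug_right : ∀ u v, contract D ε.toLinearMap (right u v) =
    S.right (contract D ε.toLinearMap u) (contract D ε.toLinearMap v)

variable {S : Dialgebra K D}

/-- Two deformations with the same base are equivalent if there is an `A`-linear isomorphism of
dialgebras between them which is compatible with `ε ⊗ id`. -/
def Deformation.Equivalent {A : Type w} [CommRing A] [Algebra K A] {ε : A →ₐ[K] K}
    (η η' : Deformation S A ε) : Prop :=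
  ∃ ρ : A ⊗[K] D ≃ₗ[A] A ⊗[K] D,
    (∀ u v, ρ (η.left u v) = η'.left (ρ u) (ρ v)) ∧
    (∀ u v, ρ (η.right u v) = η'.right (ρ u) (ρ v)) ∧
    ∀ u, contract D ε.toLinearMap (ρ u) = contract D ε.toLinearMap u

section Pushout

variable {A : Type*} [CommRing A] [Algebra K A] {B : Type*} [CommRing B] [Algebra K B]

theorem tensor_smul_rTensor (φ : A →ₐ[K] B) (a : A) (u : A ⊗[K] D) :
    φ.toLinearMap.rTensor D (a • u) = φ a • φ.toLinearMap.rTensor D u := by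
  induction u using TensorProduct.induction_on with
  | zero => simp
  | tmul s x => simp [TensorProduct.smul_tmul']
  | add u v hu hv => simp [hu, hv]

/-- The push-out along `φ` of an `A`-bilinear product `m` on `A ⊗ D`: the `B`-bilinear product on
`B ⊗ D` with `(1 ⊗ x) * (1 ⊗ y) = (φ ⊗ id) (m (1 ⊗ x) (1 ⊗ y))`, that is,
`b ⊗ (a ⊗ x) * b' ⊗ (a' ⊗ y) = b b' ⊗ m (a ⊗ x) (a' ⊗ y)` on `B ⊗_A (A ⊗ D) = B ⊗ D`. -/
def pushBilin (φ : A →ₐ[K] B) (m : A ⊗[K] D →ₗ[A] A ⊗[K] D →ₗ[A] A ⊗[K] D) :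
    B ⊗[K] D →ₗ[B] B ⊗[K] D →ₗ[B] B ⊗[K] D :=
  extendBilin (LinearMap.mk₂ K (fun x y => φ.toLinearMap.rTensor D (m (1 ⊗ₜ x) (1 ⊗ₜ y)))
    (fun x x' y => by simp [TensorProduct.tmul_add])
    (fun r x y => by
      rw [TensorProduct.tmul_smul, LinearMap.map_smul_of_tower]; simp)
    (fun x y y' => by simp [TensorProduct.tmul_add])
    (fun r x y => by
      simp))

theorem pushBilin_tmul (φ : A →ₐ[K] B) (m : A ⊗[K] D →ₗ[A] A ⊗[K] D →ₗ[A] A ⊗[K] D)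
    (s t : B) (x y : D) :
    pushBilin φ m (s ⊗ₜ x) (t ⊗ₜ y) =
      (s * t) • φ.toLinearMap.rTensor D (m (1 ⊗ₜ x) (1 ⊗ₜ y)) := by
  rw [pushBilin, extendBilin_tmul]; rfl

/-- `φ ⊗ id` intertwines a product with its push-out. -/
theorem pushBilin_rTensor (φ : A →ₐ[K] B) (m : A ⊗[K] D →ₗ[A] A ⊗[K] D →ₗ[A] A ⊗[K] D)
    (u v : A ⊗[K] D) :
    pushBilin φ m (φ.toLinearMap.rTensor D u) (φ.toLinearMap.rTensor D v) =
      φ.toLinearMap.rTensor D (m u v) := by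
  induction u using TensorProduct.induction_on with
  | zero => simp
  | add u u' hu hu' => simp [hu, hu']
  | tmul s x =>
    induction v using TensorProduct.induction_on with
    | zero => simp
    | add v v' hv hv' => rw [map_add, map_add, hv, hv', map_add, map_add]
    | tmul t y =>
      have h1 : m (s ⊗ₜ x) (t ⊗ₜ y) = (s * t) • m (1 ⊗ₜ x) (1 ⊗ₜ y) := by
        have hs : (s ⊗ₜ[K] x : A ⊗[K] D) = s • (1 ⊗ₜ x) := by simp [TensorProduct.smul_tmul']
        have ht : (t ⊗ₜ[K] y : A ⊗[K] D) = t • (1 ⊗ₜ y) := by simp [TensorProduct.smul_tmul']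
        rw [hs, ht]; simp [mul_smul, smul_comm s t]
      rw [h1, tensor_smul_rTensor, LinearMap.rTensor_tmul, LinearMap.rTensor_tmul,
        pushBilin_tmul]
      simp

/-- A trilinear map on `B ⊗ D` which vanishes on the elements `1 ⊗ x` is zero. -/
theorem trilinear_ext {N : Type*} [AddCommGroup N] [Module B N]
    {F G : B ⊗[K] D →ₗ[B] B ⊗[K] D →ₗ[B] B ⊗[K] D →ₗ[B] N}
    (h : ∀ x y z : D, F (1 ⊗ₜ x) (1 ⊗ₜ y) (1 ⊗ₜ z) = G (1 ⊗ₜ x) (1 ⊗ₜ y) (1 ⊗ₜ z)) : F = G := by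
  have hs : ∀ (s : B) (x : D), (s ⊗ₜ[K] x : B ⊗[K] D) = s • (1 ⊗ₜ x) := by
    intro s x; simp [TensorProduct.smul_tmul']
  ext u v w
  induction u using TensorProduct.induction_on with
  | zero => simp
  | add u u' hu hu' => simp [hu, hu']
  | tmul s x =>
    induction v using TensorProduct.induction_on with
    | zero => simp
    | add v v' hv hv' => simp [hv, hv']
    | tmul t y =>
      induction w using TensorProduct.induction_on with
      | zero => simp
      | add w w' hw hw' => simp [hw, hw']
      | tmul r z => rw [hs s x, hs t y, hs r z]; simp [h]

theorem op_ofDefect {R : Type*} {M : Type*} [CommRing R] [AddCommGroup M] [Module R M]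
    (m : Side → M →ₗ[R] M →ₗ[R] M) (h : ∀ y, axiomDefect m y = 0) :
    (Dialgebra.ofDefect m h).op = m := by
  funext s; cases s <;> rfl

theorem contract_smul {A : Type*} [CommRing A] [Algebra K A] (ε : A →ₐ[K] K) (a : A)
    (u : A ⊗[K] D) :
    contract D ε.toLinearMap (a • u) = ε a • contract D ε.toLinearMap u := by
  induction u using TensorProduct.induction_on with
  | zero => simp
  | tmul s x => simp [TensorProduct.smul_tmul', mul_smul]
  | add u v hu hv => rw [smul_add, map_add, hu, hv, map_add, smul_add]

/-- To check compatibility of a product on `A ⊗ D` with `ε ⊗ id`, it is enough to consider the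
elements `1 ⊗ x`. -/
theorem contract_bilin {A : Type*} [CommRing A] [Algebra K A] (ε : A →ₐ[K] K)
    (m : A ⊗[K] D →ₗ[A] A ⊗[K] D →ₗ[A] A ⊗[K] D) (o : D →ₗ[K] D →ₗ[K] D)
    (h : ∀ x y, contract D ε.toLinearMap (m (1 ⊗ₜ x) (1 ⊗ₜ y)) = o x y) (u v : A ⊗[K] D) :
    contract D ε.toLinearMap (m u v) =
      o (contract D ε.toLinearMap u) (contract D ε.toLinearMap v) := by
  have hs : ∀ (s : A) (x : D), (s ⊗ₜ[K] x : A ⊗[K] D) = s • (1 ⊗ₜ x) := by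
    intro s x; simp [TensorProduct.smul_tmul']
  induction u using TensorProduct.induction_on with
  | zero => simp
  | add u u' hu hu' => simp [hu, hu']
  | tmul s x =>
    induction v using TensorProduct.induction_on with
    | zero => simp
    | add v v' hv hv' => simp [hv, hv']
    | tmul t y =>
      rw [hs s x, hs t y]
      simp only [map_smul, LinearMap.smul_apply, contract_smul, h]
      simp

/-- Build a deformation from the products labelled by `⊣` and `⊢`. -/
def Deformation.ofOp {A : Type*} [CommRing A] [Algebra K A] {ε : A →ₐ[K] K}
    (m : Side → A ⊗[K] D →ₗ[A] A ⊗[K] D →ₗ[A] A ⊗[K] D) (h : ∀ y, axiomDefect m y = 0)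
    (h' : ∀ s x y, contract D ε.toLinearMap (m s (1 ⊗ₜ x) (1 ⊗ₜ y)) = S.op s x y) :
    Deformation S A ε where
  toDialgebra := Dialgebra.ofDefect m h
  aug_left := contract_bilin ε _ _ (h' .left)
  aug_right := contract_bilin ε _ _ (h' .right)

theorem Deformation.aug_op {A : Type*} [CommRing A] [Algebra K A] {ε : A →ₐ[K] K}
    (η : Deformation S A ε) (s : Side) (u v : A ⊗[K] D) :
    contract D ε.toLinearMap (η.op s u v) =
      S.op s (contract D ε.toLinearMap u) (contract D ε.toLinearMap v) := by
  cases s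
  · exact η.aug_left u v
  · exact η.aug_right u v

theorem contract_rTensor {A : Type*} [CommRing A] [Algebra K A] {B : Type*} [CommRing B]
    [Algebra K B] {ε : A →ₐ[K] K} {ε' : B →ₐ[K] K} (φ : A →ₐ[K] B) (hφ : ∀ a, ε' (φ a) = ε a)
    (u : A ⊗[K] D) :
    contract D ε'.toLinearMap (φ.toLinearMap.rTensor D u) = contract D ε.toLinearMap u := by
  induction u using TensorProduct.induction_on with
  | zero => simp
  | tmul s x => simp [hφ]
  | add u v hu hv => simp [hu, hv]

/-- The push-out `φ_* η` of a deformation along a homomorphism of augmented algebras. -/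
def Deformation.pushout {ε : A →ₐ[K] K} {ε' : B →ₐ[K] K} (φ : A →ₐ[K] B)
    (hφ : ∀ a, ε' (φ a) = ε a) (η : Deformation S A ε) : Deformation S B ε' :=
  Deformation.ofOp (fun s => pushBilin φ (η.op s))
    (fun y => trilinear_ext (fun x x' x'' => by
      have e : ∀ z : D, (1 ⊗ₜ[K] z : B ⊗[K] D) = φ.toLinearMap.rTensor D (1 ⊗ₜ z) := by simp
      have h := LinearMap.congr_fun (LinearMap.congr_fun (LinearMap.congr_fun
        (η.toDialgebra.axiomDefect_eq_zero y) (1 ⊗ₜ x)) (1 ⊗ₜ x')) (1 ⊗ₜ x'')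
      rw [axiomDefect_apply] at h ⊢
      rw [e x, e x', e x'']
      simp only [pushBilin_rTensor, ← map_sub, h]
      simp))
    (fun s x y => by
      rw [pushBilin_tmul, mul_one, one_smul, contract_rTensor φ hφ, η.aug_op]
      simp)

theorem Deformation.pushout_op {ε : A →ₐ[K] K} {ε' : B →ₐ[K] K} (φ : A →ₐ[K] B)
    (hφ : ∀ a, ε' (φ a) = ε a) (η : Deformation S A ε) :
    (η.pushout φ hφ).op = fun s => pushBilin φ (η.op s) := by
  funext s; cases s <;> rfl

end Pushout

end Deformations

/-! ## Harrison cohomology in degree two and extensions -/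

section Harrison

variable {K : Type u} [Field K] {A : Type w} [CommRing A] [Algebra K A]

/-- The Harrison `2`-cocycles of `A` with coefficients in a vector space `V`, on which `A` acts
through the augmentation `ε`: the symmetric bilinear maps `f : A × A → V` with
`a f(b, c) - f(ab, c) + f(a, bc) - f(a, b) c = 0`. -/
def harrZ2 (ε : A →ₐ[K] K) (V : Type*) [AddCommGroup V] [Module K V] :
    Submodule K (A →ₗ[K] A →ₗ[K] V) where
  carrier := {f | (∀ a b, f a b = f b a) ∧
    ∀ a b c, ε a • f b c - f (a * b) c + f a (b * c) - ε c • f a b = 0}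
  zero_mem' := by simp
  add_mem' {f g} hf hg := by
    refine ⟨fun a b => by simp [hf.1 a b, hg.1 a b], fun a b c => ?_⟩
    have := congrArg₂ (· + ·) (hf.2 a b c) (hg.2 a b c)
    simp only [add_zero] at this
    rw [← this]
    simp only [LinearMap.add_apply, smul_add]
    abel
  smul_mem' r f hf := by
    refine ⟨fun a b => by simp [hf.1 a b], fun a b c => ?_⟩
    have := congrArg (r • ·) (hf.2 a b c)
    simp only [smul_zero] at this
    rw [← this]
    simp only [LinearMap.smul_apply, smul_sub, smul_add, smul_comm r]

/-- The coboundary `(δ h)(a, b) = a h(b) - h(ab) + h(a) b` of a `1`-cochain `h : A → V`. -/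
def harrD1 (ε : A →ₐ[K] K) (V : Type*) [AddCommGroup V] [Module K V] :
    (A →ₗ[K] V) →ₗ[K] (A →ₗ[K] A →ₗ[K] V) where
  toFun h := LinearMap.mk₂ K (fun a b => ε a • h b - h (a * b) + ε b • h a)
    (fun a a' b => by simp only [map_add, add_mul, add_smul, smul_add]; abel)
    (fun r a b => by
      simp only [map_smul, smul_mul_assoc, smul_sub, smul_add, smul_assoc, smul_comm r])
    (fun a b b' => by simp only [map_add, mul_add, add_smul, smul_add]; abel)
    (fun r a b => by
      simp only [map_smul, mul_smul_comm, smul_sub, smul_add, smul_assoc, smul_comm r])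
  map_add' h h' := by
    refine LinearMap.ext₂ fun a b => ?_
    simp only [LinearMap.mk₂_apply, LinearMap.add_apply, smul_add]; abel
  map_smul' r h := by
    refine LinearMap.ext₂ fun a b => ?_
    simp only [LinearMap.mk₂_apply, LinearMap.smul_apply, smul_sub, smul_add, smul_comm r,
      RingHom.id_apply]

theorem harrD1_apply (ε : A →ₐ[K] K) {V : Type*} [AddCommGroup V] [Module K V] (h : A →ₗ[K] V)
    (a b : A) : harrD1 ε V h a b = ε a • h b - h (a * b) + ε b • h a := rfl

/-- `H^2_Harr(A; K)`, where `A` acts on `K` through `ε`. -/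
abbrev HarrH2 (ε : A →ₐ[K] K) : Type (max w u) :=
  Cohom (harrZ2 ε K) (LinearMap.range (harrD1 ε K))

/-- The class in `H^2_Harr(A; K)` of a cocycle. -/
abbrev HarrH2.mk (ε : A →ₐ[K] K) : harrZ2 ε K →ₗ[K] HarrH2 ε := Cohom.mk _ _

variable {ε : A →ₐ[K] K} {V : Type*} [AddCommGroup V] [Module K V]

/-- The extension `B` of `A` by `V` belonging to a Harrison cocycle `f`: the vector space `A ⊕ V`
with the product `(a, v) (b, w) = (a b, a w + b v + f(a, b))`. -/
@[ext]
structure HarrExt (f : harrZ2 ε V) where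
  base : A
  fib : V

namespace HarrExt

variable {f : harrZ2 ε V}

theorem cocycle_one (f : harrZ2 ε V) (a : A) : f.1 1 a = ε a • f.1 1 1 := by
  have h := f.2.2 1 1 a
  simp only [map_one, one_smul, one_mul, sub_self, zero_add] at h
  exact sub_eq_zero.1 h

theorem cocycle_assoc (f : harrZ2 ε V) (a b c : A) :
    f.1 (a * b) c + ε c • f.1 a b = ε a • f.1 b c + f.1 a (b * c) := by
  rw [← sub_eq_zero, ← neg_eq_zero, ← f.2.2 a b c]; abel

instance : CommRing (HarrExt f) where
  zero := ⟨0, 0⟩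
  add x y := ⟨x.base + y.base, x.fib + y.fib⟩
  neg x := ⟨-x.base, -x.fib⟩
  sub x y := ⟨x.base - y.base, x.fib - y.fib⟩
  nsmul n x := ⟨n • x.base, n • x.fib⟩
  zsmul n x := ⟨n • x.base, n • x.fib⟩
  mul x y := ⟨x.base * y.base, ε x.base • y.fib + ε y.base • x.fib + f.1 x.base y.base⟩
  one := ⟨1, -f.1 1 1⟩
  add_assoc x y z := HarrExt.ext (add_assoc _ _ _) (add_assoc _ _ _)
  zero_add x := HarrExt.ext (zero_add _) (zero_add _)
  add_zero x := HarrExt.ext (add_zero _) (add_zero _)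
  add_comm x y := HarrExt.ext (add_comm _ _) (add_comm _ _)
  neg_add_cancel x := HarrExt.ext (neg_add_cancel _) (neg_add_cancel _)
  sub_eq_add_neg x y := HarrExt.ext (sub_eq_add_neg _ _) (sub_eq_add_neg _ _)
  nsmul_zero x := HarrExt.ext (zero_nsmul _) (zero_nsmul _)
  nsmul_succ n x := HarrExt.ext (succ_nsmul _ _) (succ_nsmul _ _)
  zsmul_zero' x := HarrExt.ext (zero_zsmul _) (zero_zsmul _)
  zsmul_succ' n x := HarrExt.ext (SubNegMonoid.zsmul_succ' _ _) (SubNegMonoid.zsmul_succ' _ _)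
  zsmul_neg' n x := HarrExt.ext (SubNegMonoid.zsmul_neg' _ _) (SubNegMonoid.zsmul_neg' _ _)
  mul_comm x y := HarrExt.ext (mul_comm _ _) (by
    change ε x.base • y.fib + ε y.base • x.fib + f.1 x.base y.base =
      ε y.base • x.fib + ε x.base • y.fib + f.1 y.base x.base
    rw [f.2.1 x.base y.base]; abel)
  zero_mul x := HarrExt.ext (zero_mul _) (by
    change ε 0 • x.fib + ε x.base • (0 : V) + f.1 0 x.base = 0
    simp)
  mul_zero x := HarrExt.ext (mul_zero _) (by
    change ε x.base • (0 : V) + ε 0 • x.fib + f.1 x.base 0 = 0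
    simp)
  one_mul x := HarrExt.ext (one_mul _) (by
    change ε 1 • x.fib + ε x.base • (-f.1 1 1) + f.1 1 x.base = x.fib
    rw [cocycle_one f x.base, map_one ε, one_smul, smul_neg]; abel)
  mul_one x := HarrExt.ext (mul_one _) (by
    change ε x.base • (-f.1 1 1) + ε 1 • x.fib + f.1 x.base 1 = x.fib
    rw [f.2.1 x.base 1, cocycle_one f x.base, map_one ε, one_smul, smul_neg]; abel)
  left_distrib x y z := HarrExt.ext (mul_add _ _ _) (by
    change ε x.base • (y.fib + z.fib) + ε (y.base + z.base) • x.fib + f.1 x.base (y.base + z.base) =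
      (ε x.base • y.fib + ε y.base • x.fib + f.1 x.base y.base) +
        (ε x.base • z.fib + ε z.base • x.fib + f.1 x.base z.base)
    simp only [map_add, smul_add, add_smul]; abel)
  right_distrib x y z := HarrExt.ext (add_mul _ _ _) (by
    change ε (x.base + y.base) • z.fib + ε z.base • (x.fib + y.fib) + f.1 (x.base + y.base) z.base =
      (ε x.base • z.fib + ε z.base • x.fib + f.1 x.base z.base) +
        (ε y.base • z.fib + ε z.base • y.fib + f.1 y.base z.base)
    simp only [map_add, smul_add, add_smul, LinearMap.add_apply]; abel)
  mul_assoc x y z := HarrExt.ext (mul_assoc _ _ _) (by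
    change ε (x.base * y.base) • z.fib +
        ε z.base • (ε x.base • y.fib + ε y.base • x.fib + f.1 x.base y.base) +
          f.1 (x.base * y.base) z.base =
      ε x.base • (ε y.base • z.fib + ε z.base • y.fib + f.1 y.base z.base) +
        ε (y.base * z.base) • x.fib + f.1 x.base (y.base * z.base)
    have h := cocycle_assoc f x.base y.base z.base
    simp only [map_mul, smul_add]
    calc _ = (ε x.base * ε y.base) • z.fib + ε z.base • ε x.base • y.fib +
            ε z.base • ε y.base • x.fib +
            (f.1 (x.base * y.base) z.base + ε z.base • f.1 x.base y.base) := by abel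
      _ = _ := by
        rw [h, smul_smul, smul_smul, smul_smul, smul_smul, mul_comm (ε z.base) (ε x.base),
          mul_comm (ε z.base) (ε y.base)]
        abel)

@[simp] theorem zero_base : (0 : HarrExt f).base = 0 := rfl
@[simp] theorem zero_fib : (0 : HarrExt f).fib = 0 := rfl
@[simp] theorem add_base (x y : HarrExt f) : (x + y).base = x.base + y.base := rfl
@[simp] theorem add_fib (x y : HarrExt f) : (x + y).fib = x.fib + y.fib := rfl
@[simp] theorem one_base : (1 : HarrExt f).base = 1 := rfl
@[simp] theorem one_fib : (1 : HarrExt f).fib = -f.1 1 1 := rfl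
@[simp] theorem mul_base (x y : HarrExt f) : (x * y).base = x.base * y.base := rfl
@[simp] theorem mul_fib (x y : HarrExt f) :
    (x * y).fib = ε x.base • y.fib + ε y.base • x.fib + f.1 x.base y.base := rfl

instance : Algebra K (HarrExt f) where
  smul r x := ⟨r • x.base, r • x.fib⟩
  algebraMap :=
    { toFun := fun r => ⟨r • 1, r • (-f.1 1 1)⟩
      map_one' := HarrExt.ext (one_smul _ _) (one_smul _ _)
      map_zero' := HarrExt.ext (zero_smul _ _) (zero_smul _ _)
      map_add' := fun r s => HarrExt.ext (add_smul _ _ _) (add_smul _ _ _)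
      map_mul' := fun r s => by
        ext
        · simp [mul_smul, smul_comm s r]
        · simp only [mul_fib, map_smul, map_one, LinearMap.smul_apply, smul_eq_mul, mul_one,
            mul_smul, smul_neg, smul_comm s r]
          abel }
  commutes' r x := mul_comm _ _
  smul_def' r x := by
    ext
    · change r • x.base = r • 1 * x.base
      simp
    · change r • x.fib = ε (r • 1) • x.fib + ε x.base • r • (-f.1 1 1) + f.1 (r • 1) x.base
      simp only [map_smul, map_one, LinearMap.smul_apply, smul_eq_mul, mul_one, smul_neg,
        cocycle_one f x.base, smul_comm r]
      abel

@[simp] theorem smul_base (r : K) (x : HarrExt f) : (r • x).base = r • x.base := rfl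
@[simp] theorem smul_fib (r : K) (x : HarrExt f) : (r • x).fib = r • x.fib := rfl

/-- The projection `p : B → A`. -/
def proj (f : harrZ2 ε V) : HarrExt f →ₐ[K] A :=
  AlgHom.ofLinearMap
    { toFun := HarrExt.base, map_add' := fun _ _ => rfl, map_smul' := fun _ _ => rfl } rfl
    (fun _ _ => rfl)

/-- The inclusion `i : V → B`. -/
def incl (f : harrZ2 ε V) : V →ₗ[K] HarrExt f where
  toFun v := ⟨0, v⟩
  map_add' v w := by ext <;> simp
  map_smul' r v := by ext <;> simp

/-- The linear splitting `q : A → B`, `a ↦ (a, 0)`. -/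
def split (f : harrZ2 ε V) : A →ₗ[K] HarrExt f where
  toFun a := ⟨a, 0⟩
  map_add' v w := by ext <;> simp
  map_smul' r v := by ext <;> simp

/-- The second component `B → V`, the inverse of `i` on `ker p`. -/
def fibMap (f : harrZ2 ε V) : HarrExt f →ₗ[K] V where
  toFun := HarrExt.fib
  map_add' _ _ := rfl
  map_smul' _ _ := rfl

/-- The augmentation of `B` induced by the one of `A`. -/
def aug (f : harrZ2 ε V) : HarrExt f →ₐ[K] K := ε.comp (proj f)

@[simp] theorem proj_apply (x : HarrExt f) : proj f x = x.base := rfl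
@[simp] theorem aug_apply (x : HarrExt f) : aug f x = ε x.base := rfl
@[simp] theorem fibMap_apply (x : HarrExt f) : fibMap f x = x.fib := rfl
@[simp] theorem incl_base (v : V) : (incl f v).base = 0 := rfl
@[simp] theorem incl_fib (v : V) : (incl f v).fib = v := rfl
@[simp] theorem split_base (a : A) : (split f a).base = a := rfl
@[simp] theorem split_fib (a : A) : (split f a).fib = 0 := rfl

theorem mul_incl (x : HarrExt f) (v : V) : x * incl f v = incl f (ε x.base • v) := by
  ext <;> simp

theorem incl_mul_incl (v w : V) : incl f v * incl f w = 0 := by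
  rw [mul_incl, incl_base, map_zero, zero_smul, map_zero]

theorem aug_incl (v : V) : aug f (incl f v) = 0 := by
  rw [aug_apply, incl_base, map_zero]

end HarrExt

/-- The cocycle `f_A : (a, b) ↦ (φ ↦ μ(φ)(a, b))` with values in `H^2_Harr(A; K)'`, for a linear map
`μ` which chooses a cocycle in every class. -/
def univCocycle (μ : HarrH2 ε →ₗ[K] harrZ2 ε K) : harrZ2 ε (Module.Dual K (HarrH2 ε)) :=
  ⟨LinearMap.mk₂ K
    (fun a b => (LinearMap.applyₗ b ∘ₗ LinearMap.applyₗ a) ∘ₗ (harrZ2 ε K).subtype ∘ₗ μ)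
    (fun a a' b => by ext; simp) (fun r a b => by ext; simp)
    (fun a a' b => by ext; simp) (fun r a b => by ext; simp),
    fun a b => LinearMap.ext fun φ => (μ φ).2.1 a b,
    fun a b c => LinearMap.ext fun φ => (μ φ).2.2 a b c⟩

theorem univCocycle_apply (μ : HarrH2 ε →ₗ[K] harrZ2 ε K) (a b : A) (φ : HarrH2 ε) :
    (univCocycle μ).1 a b φ = (μ φ).1 a b := rfl

end Harrison

/-! ## Obstructions -/

section Obstruction

variable {K : Type u} {D : Type v} [Field K] [AddCommGroup D] [Module K D]

/-- The `K`-trilinear map `(x, y, z) ↦ π (F (1 ⊗ x) (1 ⊗ y) (1 ⊗ z))` on `D`. -/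
def restrictTri {B : Type*} [CommRing B] [Algebra K B] (π : B ⊗[K] D →ₗ[K] D)
    (F : B ⊗[K] D →ₗ[B] B ⊗[K] D →ₗ[B] B ⊗[K] D →ₗ[B] B ⊗[K] D) :
    D →ₗ[K] D →ₗ[K] D →ₗ[K] D where
  toFun x := LinearMap.mk₂ K (fun y z => π (F (1 ⊗ₜ x) (1 ⊗ₜ y) (1 ⊗ₜ z)))
    (fun y y' z => by simp [TensorProduct.tmul_add])
    (fun r y z => by
      rw [TensorProduct.tmul_smul, LinearMap.map_smul_of_tower, LinearMap.smul_apply, map_smul])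
    (fun y z z' => by simp [TensorProduct.tmul_add])
    (fun r y z => by rw [TensorProduct.tmul_smul, LinearMap.map_smul_of_tower, map_smul])
  map_add' x x' := by
    refine LinearMap.ext₂ fun y z => ?_
    simp [TensorProduct.tmul_add]
  map_smul' r x := by
    refine LinearMap.ext₂ fun y z => ?_
    simp only [LinearMap.mk₂_apply, LinearMap.smul_apply, RingHom.id_apply]
    rw [TensorProduct.tmul_smul, LinearMap.map_smul_of_tower, LinearMap.smul_apply,
      LinearMap.smul_apply, map_smul]

variable {S : Dialgebra K D} {A : Type w} [CommRing A] [Algebra K A] {ε : A →ₐ[K] K}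

/-- The `B`-bilinear lift to `B ⊗ D` of an `A`-bilinear product `m` on `A ⊗ D`, given on the elements
`1 ⊗ x` by `{1 ⊗ x, 1 ⊗ y} = (q ⊗ id) (m (1 ⊗ x) (1 ⊗ y))`; here `B` is the extension of `A` by `K`
belonging to `f` and `q` is the linear splitting of `B → A`. -/
def liftBilin (f : harrZ2 ε K) (m : A ⊗[K] D →ₗ[A] A ⊗[K] D →ₗ[A] A ⊗[K] D) :
    HarrExt f ⊗[K] D →ₗ[HarrExt f] HarrExt f ⊗[K] D →ₗ[HarrExt f] HarrExt f ⊗[K] D :=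
  extendBilin (LinearMap.mk₂ K
    (fun x y => (HarrExt.split f).rTensor D (m (1 ⊗ₜ x) (1 ⊗ₜ y)))
    (fun x x' y => by simp [TensorProduct.tmul_add])
    (fun r x y => by
      rw [TensorProduct.tmul_smul, LinearMap.map_smul_of_tower, LinearMap.smul_apply, map_smul])
    (fun x y y' => by simp [TensorProduct.tmul_add])
    (fun r x y => by rw [TensorProduct.tmul_smul, LinearMap.map_smul_of_tower, map_smul]))

theorem liftBilin_tmul (f : harrZ2 ε K) (m : A ⊗[K] D →ₗ[A] A ⊗[K] D →ₗ[A] A ⊗[K] D)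
    (s t : HarrExt f) (x y : D) :
    liftBilin f m (s ⊗ₜ x) (t ⊗ₜ y) =
      (s * t) • (HarrExt.split f).rTensor D (m (1 ⊗ₜ x) (1 ⊗ₜ y)) := by
  rw [liftBilin, extendBilin_tmul]; rfl

/-- The lifted products `{ , }_⊣` and `{ , }_⊢` on `B ⊗ D`. -/
abbrev liftOp (η : Deformation S A ε) (f : harrZ2 ε K) (s : Side) :
    HarrExt f ⊗[K] D →ₗ[HarrExt f] HarrExt f ⊗[K] D →ₗ[HarrExt f] HarrExt f ⊗[K] D :=
  liftBilin f (η.op s)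

/-- The obstruction cochain: the defects of the dialgebra axioms for the lifted products take values
in `ker (p ⊗ id) = D`, and this is the induced cochain `K[Y_3] ⊗ D ⊗ D ⊗ D → D`. -/
def obstrCochain (η : Deformation S A ε) (f : harrZ2 ε K) : CY3 K D :=
  fun y => restrictTri (contract D (HarrExt.fibMap f)) (axiomDefect (liftOp η f) y)

theorem obstrCochain_apply (η : Deformation S A ε) (f : harrZ2 ε K) (y : Y 3) (a b c : D) :
    obstrCochain η f y a b c = contract D (HarrExt.fibMap f)
      (axiomDefect (liftOp η f) y (1 ⊗ₜ a) (1 ⊗ₜ b) (1 ⊗ₜ c)) := rfl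

/-! ### Linearity in the Harrison cocycle, and coboundaries -/

/-- The linear map `a ⊗ d ↦ (f(a, -) ⊗ id) (g d)`. -/
def nest (f : A →ₗ[K] A →ₗ[K] K) (g : D →ₗ[K] A ⊗[K] D) : A ⊗[K] D →ₗ[K] D :=
  TensorProduct.lift (LinearMap.mk₂ K (fun a d => contract D (f a) (g d))
    (fun a a' d => by simp [contract, LinearMap.rTensor_add])
    (fun r a d => by simp [contract, LinearMap.rTensor_smul])
    (fun a d d' => by simp) (fun r a d => by simp))

@[simp] theorem nest_tmul (f : A →ₗ[K] A →ₗ[K] K) (g : D →ₗ[K] A ⊗[K] D) (a : A) (d : D) :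
    nest f g (a ⊗ₜ d) = contract D (f a) (g d) := rfl

theorem nest_add (f f' : A →ₗ[K] A →ₗ[K] K) (g : D →ₗ[K] A ⊗[K] D) (u : A ⊗[K] D) :
    nest (f + f') g u = nest f g u + nest f' g u := by
  induction u using TensorProduct.induction_on with
  | zero => simp
  | tmul a d => simp [contract, LinearMap.rTensor_add]
  | add u v hu hv => simp only [map_add, hu, hv]; abel

theorem nest_smul (r : K) (f : A →ₗ[K] A →ₗ[K] K) (g : D →ₗ[K] A ⊗[K] D) (u : A ⊗[K] D) :
    nest (r • f) g u = r • nest f g u := by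
  induction u using TensorProduct.induction_on with
  | zero => simp
  | tmul a d => simp [contract, LinearMap.rTensor_smul]
  | add u v hu hv => simp only [map_add, hu, hv, smul_add]

/-- `d ↦ m (1 ⊗ x) (1 ⊗ d)`. -/
def leftMul (m : A ⊗[K] D →ₗ[A] A ⊗[K] D →ₗ[A] A ⊗[K] D) (x : D) : D →ₗ[K] A ⊗[K] D :=
  (m (1 ⊗ₜ x)).restrictScalars K ∘ₗ TensorProduct.mk K A D 1

/-- `d ↦ m (1 ⊗ d) (1 ⊗ x)`. -/
def rightMul (m : A ⊗[K] D →ₗ[A] A ⊗[K] D →ₗ[A] A ⊗[K] D) (x : D) : D →ₗ[K] A ⊗[K] D :=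
  (m.flip (1 ⊗ₜ x)).restrictScalars K ∘ₗ TensorProduct.mk K A D 1

@[simp] theorem leftMul_apply (m : A ⊗[K] D →ₗ[A] A ⊗[K] D →ₗ[A] A ⊗[K] D) (x d : D) :
    leftMul m x d = m (1 ⊗ₜ x) (1 ⊗ₜ d) := rfl

@[simp] theorem rightMul_apply (m : A ⊗[K] D →ₗ[A] A ⊗[K] D →ₗ[A] A ⊗[K] D) (x d : D) :
    rightMul m x d = m (1 ⊗ₜ d) (1 ⊗ₜ x) := rfl

theorem tmul_eq_smul {B : Type*} [CommRing B] [Algebra K B] (s : B) (x : D) :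
    (s ⊗ₜ[K] x : B ⊗[K] D) = s • (1 ⊗ₜ x) := by simp [TensorProduct.smul_tmul']

theorem contract_split_smul (f : harrZ2 ε K) (a : A) (w : A ⊗[K] D) :
    contract D (HarrExt.fibMap f) (HarrExt.split f a • (HarrExt.split f).rTensor D w) =
      contract D (f.1 a) w := by
  induction w using TensorProduct.induction_on with
  | zero => simp
  | tmul b e => simp [TensorProduct.smul_tmul']
  | add u v hu hv => simp only [map_add, smul_add, hu, hv]

theorem contract_liftBilin_left (f : harrZ2 ε K) (m : A ⊗[K] D →ₗ[A] A ⊗[K] D →ₗ[A] A ⊗[K] D)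
    (x : D) (u : A ⊗[K] D) :
    contract D (HarrExt.fibMap f) (liftBilin f m (1 ⊗ₜ x) ((HarrExt.split f).rTensor D u)) =
      nest f.1 (leftMul m x) u := by
  induction u using TensorProduct.induction_on with
  | zero => simp
  | tmul a d =>
    rw [LinearMap.rTensor_tmul, liftBilin_tmul, one_mul, contract_split_smul, nest_tmul,
      leftMul_apply]
  | add u v hu hv => simp only [map_add, hu, hv]

theorem contract_liftBilin_right (f : harrZ2 ε K) (m : A ⊗[K] D →ₗ[A] A ⊗[K] D →ₗ[A] A ⊗[K] D)
    (x : D) (u : A ⊗[K] D) :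
    contract D (HarrExt.fibMap f) (liftBilin f m ((HarrExt.split f).rTensor D u) (1 ⊗ₜ x)) =
      nest f.1 (rightMul m x) u := by
  induction u using TensorProduct.induction_on with
  | zero => simp
  | tmul a d =>
    rw [LinearMap.rTensor_tmul, liftBilin_tmul, mul_one, contract_split_smul, nest_tmul,
      rightMul_apply]
  | add u v hu hv => simp only [map_add, LinearMap.add_apply, hu, hv]

theorem obstrCochain_eq_nest (η : Deformation S A ε) (f : harrZ2 ε K) (y : Y 3) (a b c : D) :
    obstrCochain η f y a b c =
      nest f.1 (leftMul (η.op (circ 0 y)) a) (η.op (circ 2 y) (1 ⊗ₜ b) (1 ⊗ₜ c)) -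
      nest f.1 (rightMul (η.op (circ 3 y)) c) (η.op (circ 1 y) (1 ⊗ₜ a) (1 ⊗ₜ b)) := by
  rw [obstrCochain_apply, axiomDefect_apply, map_sub, ← contract_liftBilin_left,
    ← contract_liftBilin_right, liftBilin_tmul f _ 1 1 b c, liftBilin_tmul f _ 1 1 a b, one_mul,
    one_smul, one_smul]

/-- The obstruction cochain as a linear map in the Harrison cocycle. -/
def obstrLin (η : Deformation S A ε) : harrZ2 ε K →ₗ[K] CY3 K D where
  toFun f := obstrCochain η f
  map_add' f g := by
    funext y
    refine LinearMap.ext fun a => LinearMap.ext₂ fun b c => ?_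
    simp only [Pi.add_apply, LinearMap.add_apply, obstrCochain_eq_nest, Submodule.coe_add, nest_add]
    abel
  map_smul' r f := by
    funext y
    refine LinearMap.ext fun a => LinearMap.ext₂ fun b c => ?_
    simp only [Pi.smul_apply, LinearMap.smul_apply, obstrCochain_eq_nest, Submodule.coe_smul,
      nest_smul, smul_sub, RingHom.id_apply]

theorem nest_coboundary_left (h : A →ₗ[K] K) (η : Deformation S A ε) (s : Side)
    (x : D) (u : A ⊗[K] D) :
    nest (harrD1 ε K h) (leftMul (η.op s) x) u =
      contract D h (η.op s (1 ⊗ₜ x) (1 ⊗ₜ contract D ε.toLinearMap u)) -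
        contract D h (η.op s (1 ⊗ₜ x) u) + S.op s x (contract D h u) := by
  induction u using TensorProduct.induction_on with
  | zero => simp
  | add u v hu hv =>
    simp only [map_add, TensorProduct.tmul_add, hu, hv]; abel
  | tmul a d =>
    have key : ∀ w : A ⊗[K] D, contract D (harrD1 ε K h a) w =
        ε a • contract D h w - contract D h (a • w) + h a • contract D ε.toLinearMap w := by
      intro w
      induction w using TensorProduct.induction_on with
      | zero => simp
      | tmul b e =>
        simp only [contract_tmul, harrD1_apply, TensorProduct.smul_tmul', smul_eq_mul, add_smul,
          sub_smul, mul_smul, AlgHom.toLinearMap_apply]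
        rw [smul_comm (ε b) (h a)]
      | add u v hu hv => simp only [map_add, smul_add, hu, hv]; abel
    rw [nest_tmul, key, leftMul_apply, η.aug_op, contract_tmul, contract_tmul, contract_tmul,
      contract_tmul, tmul_eq_smul a d]
    rw [(η.op s (1 ⊗ₜ x)).map_smul a (1 ⊗ₜ d)]
    simp only [map_one, one_smul, AlgHom.toLinearMap_apply]
    rw [TensorProduct.tmul_smul, (η.op s (1 ⊗ₜ x)).map_smul_of_tower (ε a),
      (contract D h).map_smul, (S.op s x).map_smul]

theorem nest_coboundary_right (h : A →ₗ[K] K) (η : Deformation S A ε) (s : Side)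
    (x : D) (u : A ⊗[K] D) :
    nest (harrD1 ε K h) (rightMul (η.op s) x) u =
      contract D h (η.op s (1 ⊗ₜ contract D ε.toLinearMap u) (1 ⊗ₜ x)) -
        contract D h (η.op s u (1 ⊗ₜ x)) + S.op s (contract D h u) x := by
  induction u using TensorProduct.induction_on with
  | zero => simp
  | add u v hu hv =>
    simp only [map_add, TensorProduct.tmul_add, LinearMap.add_apply, hu, hv]; abel
  | tmul a d =>
    have key : ∀ w : A ⊗[K] D, contract D (harrD1 ε K h a) w =
        ε a • contract D h w - contract D h (a • w) + h a • contract D ε.toLinearMap w := by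
      intro w
      induction w using TensorProduct.induction_on with
      | zero => simp
      | tmul b e =>
        simp only [contract_tmul, harrD1_apply, TensorProduct.smul_tmul', smul_eq_mul, add_smul,
          sub_smul, mul_smul, AlgHom.toLinearMap_apply]
        rw [smul_comm (ε b) (h a)]
      | add u v hu hv => simp only [map_add, smul_add, hu, hv]; abel
    rw [nest_tmul, key, rightMul_apply, η.aug_op, contract_tmul, contract_tmul, contract_tmul,
      contract_tmul, tmul_eq_smul a d]
    rw [(η.op s).map_smul a (1 ⊗ₜ d), LinearMap.smul_apply]
    simp only [map_one, one_smul, AlgHom.toLinearMap_apply]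
    rw [TensorProduct.tmul_smul, (η.op s).map_smul_of_tower (ε a), LinearMap.smul_apply,
      (contract D h).map_smul, (S.op s).map_smul, LinearMap.smul_apply]

/-- The `2`-cochain `(y; a, b) ↦ (h ⊗ id) ((1 ⊗ a) * (1 ⊗ b))` of a linear form `h` on `A`. -/
def defCochain (η : Deformation S A ε) (h : A →ₗ[K] K) : CY2 K D :=
  fun y => LinearMap.mk₂ K (fun a b => contract D h (η.op (prodSide y) (1 ⊗ₜ a) (1 ⊗ₜ b)))
    (fun x x' y => by simp [TensorProduct.tmul_add])
    (fun r x y => by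
      rw [TensorProduct.tmul_smul, LinearMap.map_smul_of_tower, LinearMap.smul_apply, map_smul])
    (fun x y y' => by simp [TensorProduct.tmul_add])
    (fun r x y => by rw [TensorProduct.tmul_smul, LinearMap.map_smul_of_tower, map_smul])

theorem defCochain_apply (η : Deformation S A ε) (h : A →ₗ[K] K) (y : Y 2) (a b : D) :
    defCochain η h y a b = contract D h (η.op (prodSide y) (1 ⊗ₜ a) (1 ⊗ₜ b)) := rfl

theorem obstrCochain_coboundary (η : Deformation S A ε) (f : harrZ2 ε K) (h : A →ₗ[K] K)
    (hf : harrD1 ε K h = f.1) : obstrCochain η f = delta2 S (defCochain η h) := by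
  funext y
  refine LinearMap.ext fun a => LinearMap.ext₂ fun b c => ?_
  obtain ⟨h0, h1, h2, h3⟩ := prodSide_face y
  have hz := LinearMap.congr_fun (LinearMap.congr_fun (LinearMap.congr_fun
    (η.toDialgebra.axiomDefect_eq_zero y) (1 ⊗ₜ a)) (1 ⊗ₜ b)) (1 ⊗ₜ c)
  rw [axiomDefect_apply] at hz
  have hz' := sub_eq_zero.1 hz
  rw [obstrCochain_eq_nest, ← hf, nest_coboundary_left, nest_coboundary_right, delta2_apply,
    defCochain_apply, defCochain_apply, defCochain_apply, defCochain_apply, h0, h1, h2, h3, hz',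
    η.aug_op, η.aug_op]
  simp only [contract_tmul, AlgHom.toLinearMap_apply, map_one, one_smul]
  abel

/-! ### The obstruction cochain is a cocycle -/

section Cocycle

variable (η : Deformation S A ε) (f : harrZ2 ε K)

theorem proj_split (u : A ⊗[K] D) :
    (HarrExt.proj f).toLinearMap.rTensor D ((HarrExt.split f).rTensor D u) = u := by
  induction u using TensorProduct.induction_on with
  | zero => simp
  | tmul a d => simp
  | add u v hu hv => simp only [map_add, hu, hv]

theorem proj_liftOp (s : Side) (u v : HarrExt f ⊗[K] D) :
    (HarrExt.proj f).toLinearMap.rTensor D (liftOp η f s u v) =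
      η.op s ((HarrExt.proj f).toLinearMap.rTensor D u)
        ((HarrExt.proj f).toLinearMap.rTensor D v) := by
  induction u using TensorProduct.induction_on with
  | zero => simp
  | add u u' hu hu' => simp only [map_add, LinearMap.add_apply, hu, hu']
  | tmul s' x =>
    induction v using TensorProduct.induction_on with
    | zero => simp
    | add v v' hv hv' => simp only [map_add, hv, hv']
    | tmul t y =>
      rw [liftOp, liftBilin_tmul, tensor_smul_rTensor, proj_split, LinearMap.rTensor_tmul,
        LinearMap.rTensor_tmul, tmul_eq_smul ((HarrExt.proj f).toLinearMap s') x,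
        tmul_eq_smul ((HarrExt.proj f).toLinearMap t) y]
      simp only [map_smul, LinearMap.smul_apply, map_mul, mul_smul, AlgHom.toLinearMap_apply]
      rw [smul_comm]

theorem aug_liftOp (s : Side) (u v : HarrExt f ⊗[K] D) :
    contract D (HarrExt.aug f).toLinearMap (liftOp η f s u v) =
      S.op s (contract D (HarrExt.aug f).toLinearMap u)
        (contract D (HarrExt.aug f).toLinearMap v) := by
  have h : ∀ w : HarrExt f ⊗[K] D, contract D (HarrExt.aug f).toLinearMap w =
      contract D ε.toLinearMap ((HarrExt.proj f).toLinearMap.rTensor D w) := fun w =>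
    (contract_rTensor (HarrExt.proj f) (fun _ => rfl) w).symm
  rw [h, h, h, proj_liftOp, η.aug_op]

/-- An element of `ker (p ⊗ id)` lies in the image of `i ⊗ id`. -/
theorem eq_incl_smul (w : HarrExt f ⊗[K] D) :
    w = (HarrExt.split f).rTensor D ((HarrExt.proj f).toLinearMap.rTensor D w) +
      HarrExt.incl f 1 • (1 ⊗ₜ contract D (HarrExt.fibMap f) w) := by
  induction w using TensorProduct.induction_on with
  | zero => simp
  | add u v hu hv =>
    conv_lhs => rw [hu, hv]
    simp only [map_add, TensorProduct.tmul_add, smul_add]; abel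
  | tmul b x =>
    rw [contract_tmul, TensorProduct.tmul_smul, TensorProduct.smul_tmul',
      TensorProduct.smul_tmul', LinearMap.rTensor_tmul, LinearMap.rTensor_tmul,
      ← TensorProduct.add_tmul]
    congr 1
    ext <;> simp

theorem incl_smul (w : HarrExt f ⊗[K] D) :
    HarrExt.incl f 1 • w = HarrExt.incl f 1 • (1 ⊗ₜ contract D (HarrExt.aug f).toLinearMap w) := by
  induction w using TensorProduct.induction_on with
  | zero => simp
  | add u v hu hv => simp only [map_add, TensorProduct.tmul_add, smul_add, hu, hv]
  | tmul b x =>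
    rw [contract_tmul, TensorProduct.smul_tmul', TensorProduct.tmul_smul, smul_comm,
      TensorProduct.smul_tmul', TensorProduct.smul_tmul']
    congr 1
    rw [smul_eq_mul, smul_eq_mul, mul_comm, HarrExt.mul_incl]
    ext <;> simp

theorem contract_incl_smul (d : D) :
    contract D (HarrExt.fibMap f) (HarrExt.incl f 1 • (1 ⊗ₜ d : HarrExt f ⊗[K] D)) = d := by
  rw [TensorProduct.smul_tmul', contract_tmul, smul_eq_mul, mul_one]
  simp

/-- The defects of the lifted products, in terms of the obstruction cochain. -/
theorem axiomDefect_liftOp (y : Y 3) (u v w : HarrExt f ⊗[K] D) :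
    axiomDefect (liftOp η f) y u v w = HarrExt.incl f 1 •
      (1 ⊗ₜ obstrCochain η f y (contract D (HarrExt.aug f).toLinearMap u)
        (contract D (HarrExt.aug f).toLinearMap v) (contract D (HarrExt.aug f).toLinearMap w)) := by
  have base : ∀ a b c : D, axiomDefect (liftOp η f) y (1 ⊗ₜ a) (1 ⊗ₜ b) (1 ⊗ₜ c) =
      HarrExt.incl f 1 • (1 ⊗ₜ obstrCochain η f y a b c) := by
    intro a b c
    have h0 : (HarrExt.proj f).toLinearMap.rTensor D
        (axiomDefect (liftOp η f) y (1 ⊗ₜ a) (1 ⊗ₜ b) (1 ⊗ₜ c)) = 0 := by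
      rw [axiomDefect_apply, map_sub, proj_liftOp, proj_liftOp, proj_liftOp, proj_liftOp]
      have hz := LinearMap.congr_fun (LinearMap.congr_fun (LinearMap.congr_fun
        (η.toDialgebra.axiomDefect_eq_zero y) (1 ⊗ₜ a)) (1 ⊗ₜ b)) (1 ⊗ₜ c)
      simpa [axiomDefect_apply] using hz
    rw [eq_incl_smul f (axiomDefect (liftOp η f) y (1 ⊗ₜ a) (1 ⊗ₜ b) (1 ⊗ₜ c)), h0, map_zero,
      zero_add, obstrCochain_apply]
  have sm : ∀ (b : HarrExt f) (d : D),
      b • HarrExt.incl f 1 • (1 ⊗ₜ d : HarrExt f ⊗[K] D) =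
        HarrExt.incl f 1 • (1 ⊗ₜ (HarrExt.aug f b • d)) := by
    intro b d
    rw [smul_comm, incl_smul, contract_smul, contract_tmul]
    simp
  induction u using TensorProduct.induction_on with
  | zero => simp
  | add u u' hu hu' =>
    simp only [map_add, LinearMap.add_apply, hu, hu', TensorProduct.tmul_add, smul_add]
  | tmul r x =>
    induction v using TensorProduct.induction_on with
    | zero => simp
    | add v v' hv hv' =>
      simp only [map_add, LinearMap.add_apply, hv, hv', TensorProduct.tmul_add, smul_add]
    | tmul s y' =>
      induction w using TensorProduct.induction_on with
      | zero => simp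
      | add w w' hw hw' => simp only [map_add, hw, hw', TensorProduct.tmul_add, smul_add]
      | tmul t z =>
        rw [tmul_eq_smul r x, tmul_eq_smul s y', tmul_eq_smul t z]
        simp only [map_smul, LinearMap.smul_apply, base, sm, contract_smul, contract_tmul,
          AlgHom.toLinearMap_apply, map_one, one_smul]

theorem fib_liftOp_right (s : Side) (a : D) (d : D) :
    contract D (HarrExt.fibMap f)
      (liftOp η f s (1 ⊗ₜ a) (HarrExt.incl f 1 • (1 ⊗ₜ d))) = S.op s a d := by
  rw [map_smul, incl_smul, contract_incl_smul, aug_liftOp]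
  simp

theorem fib_liftOp_left (s : Side) (a : D) (d : D) :
    contract D (HarrExt.fibMap f)
      (liftOp η f s (HarrExt.incl f 1 • (1 ⊗ₜ d)) (1 ⊗ₜ a)) = S.op s d a := by
  rw [map_smul, LinearMap.smul_apply, incl_smul, contract_incl_smul, aug_liftOp]
  simp

theorem fib_axiomDefect (y : Y 3) (u v w : HarrExt f ⊗[K] D) :
    contract D (HarrExt.fibMap f) (axiomDefect (liftOp η f) y u v w) =
      obstrCochain η f y (contract D (HarrExt.aug f).toLinearMap u)
        (contract D (HarrExt.aug f).toLinearMap v) (contract D (HarrExt.aug f).toLinearMap w) := by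
  rw [axiomDefect_liftOp, contract_incl_smul]

theorem obstrCochain_mem (η : Deformation S A ε) (f : harrZ2 ε K) :
    obstrCochain η f ∈ ZY3 S := by
  rw [LinearMap.mem_ker]
  funext y a b c d
  have e1 : ∀ x : D, contract D (HarrExt.aug f).toLinearMap (1 ⊗ₜ x) = x := by intro x; simp
  have t0 : S.op (circ 0 y) a (obstrCochain η f (face 0 y) b c d) =
      contract D (HarrExt.fibMap f) (liftOp η f (circ 0 y) (1 ⊗ₜ a)
        (axiomDefect (liftOp η f) (face 0 y) (1 ⊗ₜ b) (1 ⊗ₜ c) (1 ⊗ₜ d))) := by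
    rw [axiomDefect_liftOp, fib_liftOp_right, e1, e1, e1]
  have t1 : obstrCochain η f (face 1 y) (S.op (circ 1 y) a b) c d =
      contract D (HarrExt.fibMap f) (axiomDefect (liftOp η f) (face 1 y)
        (liftOp η f (circ 1 y) (1 ⊗ₜ a) (1 ⊗ₜ b)) (1 ⊗ₜ c) (1 ⊗ₜ d)) := by
    rw [fib_axiomDefect, aug_liftOp, e1, e1, e1, e1]
  have t2 : obstrCochain η f (face 2 y) a (S.op (circ 2 y) b c) d =
      contract D (HarrExt.fibMap f) (axiomDefect (liftOp η f) (face 2 y) (1 ⊗ₜ a)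
        (liftOp η f (circ 2 y) (1 ⊗ₜ b) (1 ⊗ₜ c)) (1 ⊗ₜ d)) := by
    rw [fib_axiomDefect, aug_liftOp, e1, e1, e1, e1]
  have t3 : obstrCochain η f (face 3 y) a b (S.op (circ 3 y) c d) =
      contract D (HarrExt.fibMap f) (axiomDefect (liftOp η f) (face 3 y) (1 ⊗ₜ a) (1 ⊗ₜ b)
        (liftOp η f (circ 3 y) (1 ⊗ₜ c) (1 ⊗ₜ d))) := by
    rw [fib_axiomDefect, aug_liftOp, e1, e1, e1, e1]
  have t4 : S.op (circ 4 y) (obstrCochain η f (face 4 y) a b c) d =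
      contract D (HarrExt.fibMap f) (liftOp η f (circ 4 y)
        (axiomDefect (liftOp η f) (face 4 y) (1 ⊗ₜ a) (1 ⊗ₜ b) (1 ⊗ₜ c)) (1 ⊗ₜ d)) := by
    rw [axiomDefect_liftOp, fib_liftOp_left, e1, e1, e1]
  rw [delta3_apply, t0, t1, t2, t3, t4, ← map_sub, ← map_add, ← map_sub, ← map_add]
  obtain ⟨⟨p1, p2, p3⟩, ⟨q1, q2, q3⟩, ⟨r1, r2, r3⟩, ⟨s1, s2, s3⟩, ⟨u1, u2, u3⟩⟩ := circ_face y
  simp only [axiomDefect_apply, map_sub, LinearMap.sub_apply]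
  rw [← p1, ← p2, p3, ← q1, ← q2, q3, r1, r2, ← r3, s1, s2, ← s3, u1, u2, ← u3]
  simp only [Pi.zero_apply]
  abel_nf
  exact map_zero _

end Cocycle

/-- The obstruction map `𝕆_η : H^2_Harr(A; K) → HY^3(D, D)` of a deformation `η` with base `A`. -/
def obstruction (η : Deformation S A ε) : HarrH2 ε →ₗ[K] HY3 S :=
  Cohom.lift (HY3.mk S ∘ₗ (obstrLin η).codRestrict (ZY3 S) (obstrCochain_mem η)) (by
    rintro f ⟨h, hh⟩
    rw [LinearMap.comp_apply, Cohom.mk_eq_zero_iff]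
    exact ⟨defCochain η h, (obstrCochain_coboundary η f h hh).symm⟩)

theorem obstruction_mk (η : Deformation S A ε) (f : harrZ2 ε K) :
    obstruction η (HarrH2.mk ε f) = HY3.mk S ⟨obstrCochain η f, obstrCochain_mem η f⟩ := rfl

end Obstruction

/-! ## The universal infinitesimal deformation -/

section Infinitesimal

variable {K : Type u} {D : Type v} [Field K] [AddCommGroup D] [Module K D]

/-- The `2`-tree of a product: `[21]` for `⊣` and `[12]` for `⊢`. -/
def sideTree : Side → Y 2
  | .left => ⟨.node () .nil (.node () .nil .nil), rfl⟩
  | .right => ⟨.node () (.node () .nil .nil) .nil, rfl⟩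

theorem sideTree_prodSide (y : Y 2) : sideTree (prodSide y) = y := by
  have key : ∀ t ∈ trees2, ∀ h : t.numNodes = 2,
      (sideTree (prodSide (⟨t, h⟩ : Y 2))).1 = t := by decide
  exact Subtype.ext (key y.1 (mem_trees2 y.1 y.2) y.2)

/-- The linear map `α ↦ μ(α)(y; x, x')` on `HY^2(D, D)`. -/
def evalCocycle {S : Dialgebra K D} (μ : HY2 S →ₗ[K] ZY2 S) (y : Y 2) :
    D →ₗ[K] D →ₗ[K] HY2 S →ₗ[K] D :=
  LinearMap.mk₂ K
    (fun x x' => LinearMap.applyₗ x' ∘ₗ LinearMap.applyₗ x ∘ₗ LinearMap.proj y ∘ₗ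
      (ZY2 S).subtype ∘ₗ μ)
    (fun x x' z => LinearMap.ext fun α => by simp)
    (fun r x z => LinearMap.ext fun α => by simp)
    (fun x z z' => LinearMap.ext fun α => by simp)
    (fun r x z => LinearMap.ext fun α => by simp)

theorem evalCocycle_apply {S : Dialgebra K D} (μ : HY2 S →ₗ[K] ZY2 S) (y : Y 2) (x x' : D)
    (α : HY2 S) : evalCocycle μ y x x' α = (μ α).1 y x x' := rfl

/-- The cocycle condition for `μ(α)`, `α ∈ HY^2(D, D)`. -/
theorem evalCocycle_assoc {S : Dialgebra K D} (μ : HY2 S →ₗ[K] ZY2 S) (y : Y 3) (a b c : D) :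
    evalCocycle μ (sideTree (circ 0 y)) a (S.op (circ 2 y) b c) +
        S.op (circ 0 y) a ∘ₗ evalCocycle μ (sideTree (circ 2 y)) b c =
      evalCocycle μ (sideTree (circ 3 y)) (S.op (circ 1 y) a b) c +
        (S.op (circ 3 y)).flip c ∘ₗ evalCocycle μ (sideTree (circ 1 y)) a b := by
  obtain ⟨h0, h1, h2, h3⟩ := prodSide_face y
  refine LinearMap.ext fun α => ?_
  have hα := LinearMap.congr_fun (LinearMap.congr_fun (LinearMap.congr_fun
    (congrFun (LinearMap.mem_ker.1 (μ α).2) y) a) b) c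
  rw [delta2_apply] at hα
  simp only [LinearMap.add_apply, LinearMap.comp_apply, evalCocycle_apply, LinearMap.flip_apply]
  have e0 := sideTree_prodSide (face 0 y)
  have e1 := sideTree_prodSide (face 1 y)
  have e2 := sideTree_prodSide (face 2 y)
  have e3 := sideTree_prodSide (face 3 y)
  rw [h0] at e0
  rw [h1] at e1
  rw [h2] at e2
  rw [h3] at e3
  rw [e0, e1, e2, e3, ← sub_eq_zero]
  refine Eq.trans ?_ hα
  abel

section SquareZero

variable {H : Type*} [AddCommGroup H] [Module K H] {B : Type*} [CommRing B] [Algebra K B]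
  (j : Module.Dual K H →ₗ[K] B) [FiniteDimensional K H]

variable (D) in
/-- For `j : H' → B`, the map `j ⊗ id : Hom(H, D) = H' ⊗ D → B ⊗ D`. -/
def homIncl : (H →ₗ[K] D) →ₗ[K] B ⊗[K] D :=
  j.rTensor D ∘ₗ (dualTensorHomEquiv K H D).symm.toLinearMap

theorem homIncl_dualTensorHom (ξ : Module.Dual K H) (d : D) :
    homIncl D j (dualTensorHom K H D (ξ ⊗ₜ d)) = j ξ ⊗ₜ d := by
  have h : (dualTensorHomEquiv K H D).symm (dualTensorHom K H D (ξ ⊗ₜ d)) = ξ ⊗ₜ d :=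
    (dualTensorHomEquiv K H D).symm_apply_apply (ξ ⊗ₜ d)
  rw [homIncl, LinearMap.comp_apply, LinearEquiv.coe_coe, h, LinearMap.rTensor_tmul]

/-- Induction principle for `Hom(H, D) = H' ⊗ D`. -/
theorem hom_induction {P : (H →ₗ[K] D) → Prop} (h0 : P 0)
    (h1 : ∀ (ξ : Module.Dual K H) (d : D), P (dualTensorHom K H D (ξ ⊗ₜ d)))
    (h2 : ∀ w w', P w → P w' → P (w + w')) (w : H →ₗ[K] D) : P w := by
  have h : ∀ t : Module.Dual K H ⊗[K] D, P (dualTensorHom K H D t) := by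
    intro t
    induction t using TensorProduct.induction_on with
    | zero => rw [map_zero]; exact h0
    | tmul ξ d => exact h1 ξ d
    | add t t' ht ht' => rw [map_add]; exact h2 _ _ ht ht'
  obtain ⟨t, rfl⟩ := (dualTensorHomEquiv K H D).surjective w
  exact h t

theorem incl_smul_homIncl (hj : ∀ ξ ξ', j ξ * j ξ' = 0) (ξ : Module.Dual K H) (w : H →ₗ[K] D) :
    j ξ • homIncl D j w = 0 := by
  induction w using hom_induction with
  | h0 => rw [map_zero, smul_zero]
  | h1 ξ' d =>
    rw [homIncl_dualTensorHom, TensorProduct.smul_tmul', smul_eq_mul, hj,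
      TensorProduct.zero_tmul]
  | h2 w w' hw hw' => rw [map_add, smul_add, hw, hw', add_zero]

theorem contract_homIncl {ε : B →ₐ[K] K} (hε : ∀ ξ, ε (j ξ) = 0) (w : H →ₗ[K] D) :
    contract D ε.toLinearMap (homIncl D j w) = 0 := by
  induction w using hom_induction with
  | h0 => rw [map_zero, map_zero]
  | h1 ξ' d => rw [homIncl_dualTensorHom, contract_tmul, AlgHom.toLinearMap_apply, hε, zero_smul]
  | h2 w w' hw hw' => rw [map_add, map_add, hw, hw', add_zero]

variable (S : Dialgebra K D) (T : Side → D →ₗ[K] D →ₗ[K] H →ₗ[K] D)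

/-- The `B`-bilinear products on `B ⊗ D` with `x * x' = (x * x') + T(x, x')` for `x, x' ∈ D`, where
`Hom(H, D) = H' ⊗ D` is mapped to `B ⊗ D` by `j ⊗ id`. -/
def sqZeroOp (s : Side) :
    B ⊗[K] D →ₗ[B] B ⊗[K] D →ₗ[B] B ⊗[K] D :=
  extendBilin ((S.op s).compr₂ (TensorProduct.mk K B D 1) +
    (T s).compr₂ (homIncl D j))

theorem sqZeroOp_one (s : Side) (x x' : D) :
    sqZeroOp j S T s (1 ⊗ₜ x) (1 ⊗ₜ x') = 1 ⊗ₜ S.op s x x' + homIncl D j (T s x x') := by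
  rw [sqZeroOp, extendBilin_tmul, one_mul, one_smul]; rfl

theorem sqZeroOp_homIncl_right (hj : ∀ ξ ξ', j ξ * j ξ' = 0) (s : Side) (x : D) (w : H →ₗ[K] D) :
    sqZeroOp j S T s (1 ⊗ₜ x) (homIncl D j w) = homIncl D j (S.op s x ∘ₗ w) := by
  induction w using hom_induction with
  | h0 => rw [LinearMap.comp_zero, map_zero, map_zero]
  | h1 ξ d =>
    have h : S.op s x ∘ₗ dualTensorHom K H D (ξ ⊗ₜ d) =
        dualTensorHom K H D (ξ ⊗ₜ S.op s x d) := LinearMap.ext fun α => by simp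
    rw [h, homIncl_dualTensorHom, homIncl_dualTensorHom, tmul_eq_smul (j ξ) d,
      (sqZeroOp j S T s (1 ⊗ₜ x)).map_smul, sqZeroOp_one, smul_add, incl_smul_homIncl j hj, add_zero,
      ← tmul_eq_smul]
  | h2 w w' hw hw' =>
    rw [(homIncl D j).map_add, (sqZeroOp j S T s (1 ⊗ₜ x)).map_add, hw, hw', LinearMap.comp_add,
      (homIncl D j).map_add]

theorem sqZeroOp_homIncl_left (hj : ∀ ξ ξ', j ξ * j ξ' = 0) (s : Side) (x : D) (w : H →ₗ[K] D) :
    sqZeroOp j S T s (homIncl D j w) (1 ⊗ₜ x) = homIncl D j ((S.op s).flip x ∘ₗ w) := by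
  induction w using hom_induction with
  | h0 => rw [LinearMap.comp_zero, map_zero, map_zero, LinearMap.zero_apply]
  | h1 ξ d =>
    have h : (S.op s).flip x ∘ₗ dualTensorHom K H D (ξ ⊗ₜ d) =
        dualTensorHom K H D (ξ ⊗ₜ S.op s d x) := LinearMap.ext fun α => by simp
    rw [h, homIncl_dualTensorHom, homIncl_dualTensorHom, tmul_eq_smul (j ξ) d,
      (sqZeroOp j S T s).map_smul, LinearMap.smul_apply, sqZeroOp_one, smul_add, incl_smul_homIncl j hj,
      add_zero, ← tmul_eq_smul]
  | h2 w w' hw hw' =>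
    rw [(homIncl D j).map_add, (sqZeroOp j S T s).map_add, LinearMap.add_apply, hw, hw',
      LinearMap.comp_add, (homIncl D j).map_add]

theorem axiomDefect_sqZeroOp (hj : ∀ ξ ξ', j ξ * j ξ' = 0) (y : Y 3) (h : ∀ a b c : D,
      T (circ 0 y) a (S.op (circ 2 y) b c) + S.op (circ 0 y) a ∘ₗ T (circ 2 y) b c =
      T (circ 3 y) (S.op (circ 1 y) a b) c + (S.op (circ 3 y)).flip c ∘ₗ T (circ 1 y) a b) :
    axiomDefect (sqZeroOp j S T) y = 0 := by
  refine trilinear_ext fun a b c => ?_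
  have hS := LinearMap.congr_fun (LinearMap.congr_fun (LinearMap.congr_fun
    (S.axiomDefect_eq_zero y) a) b) c
  rw [axiomDefect_apply] at hS
  rw [axiomDefect_apply, sqZeroOp_one j S T _ b c, sqZeroOp_one j S T _ a b,
    (sqZeroOp j S T (circ 0 y) (1 ⊗ₜ a)).map_add, (sqZeroOp j S T (circ 3 y)).map_add,
    LinearMap.add_apply, sqZeroOp_one, sqZeroOp_one, sqZeroOp_homIncl_right j S T hj,
    sqZeroOp_homIncl_left j S T hj, sub_eq_zero.1 hS, add_assoc, add_assoc, ← (homIncl D j).map_add,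
    ← (homIncl D j).map_add, h a b c, sub_self]
  rfl

/-- The deformation with the products `sqZeroOp`. -/
def sqZeroDeformation {ε : B →ₐ[K] K} (hj : ∀ ξ ξ', j ξ * j ξ' = 0) (hε : ∀ ξ, ε (j ξ) = 0)
    (h : ∀ (y : Y 3) (a b c : D),
      T (circ 0 y) a (S.op (circ 2 y) b c) + S.op (circ 0 y) a ∘ₗ T (circ 2 y) b c =
      T (circ 3 y) (S.op (circ 1 y) a b) c + (S.op (circ 3 y)).flip c ∘ₗ T (circ 1 y) a b) :
    Deformation S B ε :=
  Deformation.ofOp (sqZeroOp j S T) (fun y => axiomDefect_sqZeroOp j S T hj y (h y))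
    (fun s x x' => by
      rw [sqZeroOp_one, LinearMap.map_add, contract_homIncl j hε, contract_tmul, add_zero,
        AlgHom.toLinearMap_apply, map_one, one_smul])

theorem sqZeroDeformation_op {ε : B →ₐ[K] K} (hj : ∀ ξ ξ', j ξ * j ξ' = 0)
    (hε : ∀ ξ, ε (j ξ) = 0)
    (h : ∀ (y : Y 3) (a b c : D),
      T (circ 0 y) a (S.op (circ 2 y) b c) + S.op (circ 0 y) a ∘ₗ T (circ 2 y) b c =
      T (circ 3 y) (S.op (circ 1 y) a b) c + (S.op (circ 3 y)).flip c ∘ₗ T (circ 1 y) a b) :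
    (sqZeroDeformation j S T hj hε h).op = sqZeroOp j S T :=
  op_ofDefect _ (fun y => axiomDefect_sqZeroOp j S T hj y (h y))

end SquareZero

variable (S : Dialgebra K D)

/-- The zero cocycle of `C_0 = K` with values in `HY^2(D, D)'`. -/
def infCocycle : harrZ2 (AlgHom.id K K) (Module.Dual K (HY2 S)) := 0

/-- `C_1 = K ⊕ HY^2(D, D)'`, with `HY^2(D, D)'` an ideal of square zero: the extension of `C_0 = K`
by `HY^2(D, D)'` belonging to the zero cocycle. -/
abbrev InfBase : Type (max u v) := HarrExt (infCocycle S)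

/-- The inclusion `i : HY^2(D, D)' → C_1`. -/
abbrev infIncl : Module.Dual K (HY2 S) →ₗ[K] InfBase S := HarrExt.incl (infCocycle S)

/-- The augmentation of `C_1`. -/
abbrev infAug : InfBase S →ₐ[K] K := HarrExt.aug (infCocycle S)

variable {S} [FiniteDimensional K (HY2 S)]

/-- The universal infinitesimal deformation `η_1` with base `C_1`, for a linear map `μ` which chooses
a cocycle in every class of `HY^2(D, D)`. Its products are the `C_1`-bilinear products on
`C_1 ⊗ D = D ⊕ Hom(HY^2(D, D), D)` with `x * x' = (x * x', α ↦ μ(α)(y; x, x'))` for `x, x' ∈ D`,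
where `y = [21]` for `* = ⊣` and `y = [12]` for `* = ⊢`. -/
def universalInfinitesimal (μ : HY2 S →ₗ[K] ZY2 S) : Deformation S (InfBase S) (infAug S) :=
  sqZeroDeformation (infIncl S) S (fun s => evalCocycle μ (sideTree s))
    HarrExt.incl_mul_incl HarrExt.aug_incl
    (evalCocycle_assoc μ)

end Infinitesimal

/-! ## The inductive construction -/

section Construction

variable {K : Type u} {D : Type v} [Field K] [AddCommGroup D] [Module K D] {S : Dialgebra K D}
  {C : Type w} [CommRing C] [Algebra K C] {ε : C →ₐ[K] K}

/-- The ideal `ī (ω' (HY^3(D, D)'))` of the extension `C̄` of `C` by `H^2_Harr(C; K)'`, where `ω'` is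
the dual of the obstruction map `ω` of `η`. -/
def obstrIdeal (η : Deformation S C ε) (μ : HarrH2 ε →ₗ[K] harrZ2 ε K) :
    Ideal (HarrExt (univCocycle μ)) where
  carrier := {x | ∃ ψ : Module.Dual K (HY3 S),
    HarrExt.incl (univCocycle μ) ((obstruction η).dualMap ψ) = x}
  zero_mem' := ⟨0, by simp⟩
  add_mem' := by
    rintro _ _ ⟨ψ, rfl⟩ ⟨ψ', rfl⟩
    exact ⟨ψ + ψ', by simp⟩
  smul_mem' := by
    rintro c _ ⟨ψ, rfl⟩
    exact ⟨ε c.base • ψ, by rw [smul_eq_mul, HarrExt.mul_incl, map_smul]⟩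

theorem mem_obstrIdeal {η : Deformation S C ε} {μ : HarrH2 ε →ₗ[K] harrZ2 ε K}
    {x : HarrExt (univCocycle μ)} : x ∈ obstrIdeal η μ ↔ ∃ ψ : Module.Dual K (HY3 S),
      HarrExt.incl (univCocycle μ) ((obstruction η).dualMap ψ) = x := Iff.rfl

/-- `C_{k+1} = C̄_{k+1} / ī_{k+1} (ω_k' (HY^3(D, D)'))`. -/
abbrev NextBase (η : Deformation S C ε) (μ : HarrH2 ε →ₗ[K] harrZ2 ε K) : Type (max w u) :=
  HarrExt (univCocycle μ) ⧸ obstrIdeal η μ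

/-- The projection `p_{k+1} : C_{k+1} → C_k`. -/
def nextProj (η : Deformation S C ε) (μ : HarrH2 ε →ₗ[K] harrZ2 ε K) : NextBase η μ →ₐ[K] C :=
  Ideal.Quotient.liftₐ (obstrIdeal η μ) (HarrExt.proj (univCocycle μ)) (by
    rintro _ ⟨ψ, rfl⟩
    rfl)

/-- The augmentation of `C_{k+1}`. -/
def nextAug (η : Deformation S C ε) (μ : HarrH2 ε →ₗ[K] harrZ2 ε K) : NextBase η μ →ₐ[K] K :=
  ε.comp (nextProj η μ)

/-- The map `i_{k+1} : (ker ω_k)' → C_{k+1}` induced by `ī_{k+1}`: it sends the restriction of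
`ψ ∈ H^2_Harr(C_k; K)'` to `ker ω_k` to the class of `ī_{k+1}(ψ)`. -/
def nextIncl (η : Deformation S C ε) (μ : HarrH2 ε →ₗ[K] harrZ2 ε K) :
    Module.Dual K (LinearMap.ker (obstruction η)) →ₗ[K] NextBase η μ :=
  Submodule.liftQ (Submodule.dualAnnihilator (LinearMap.ker (obstruction η)))
    ((Ideal.Quotient.mkₐ K (obstrIdeal η μ)).toLinearMap ∘ₗ HarrExt.incl (univCocycle μ)) (by
      intro ψ hψ
      rw [← LinearMap.range_dualMap_eq_dualAnnihilator_ker] at hψ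
      obtain ⟨χ, rfl⟩ := hψ
      rw [LinearMap.mem_ker, LinearMap.comp_apply, AlgHom.toLinearMap_apply,
        Ideal.Quotient.mkₐ_eq_mk, Ideal.Quotient.eq_zero_iff_mem]
      exact ⟨χ, rfl⟩) ∘ₗ
  (Subspace.quotAnnihilatorEquiv (LinearMap.ker (obstruction η))).symm.toLinearMap

theorem nextIncl_restrict (η : Deformation S C ε) (μ : HarrH2 ε →ₗ[K] harrZ2 ε K)
    (ψ : Module.Dual K (HarrH2 ε)) :
    nextIncl η μ (ψ ∘ₗ (LinearMap.ker (obstruction η)).subtype) =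
      Ideal.Quotient.mk (obstrIdeal η μ) (HarrExt.incl (univCocycle μ) ψ) := by
  have h : (Subspace.quotAnnihilatorEquiv (LinearMap.ker (obstruction η))).symm
      (ψ ∘ₗ (LinearMap.ker (obstruction η)).subtype) = Submodule.Quotient.mk ψ := by
    rw [LinearEquiv.symm_apply_eq, Subspace.quotAnnihilatorEquiv_apply]
    rfl
  rw [nextIncl, LinearMap.comp_apply, LinearEquiv.coe_coe, h]
  rfl

end Construction

/-- `IsStage S k C ε η` says that the augmented algebra `(C, ε)` and the deformation `η` of `S` with
base `C` are a `k`-th stage `(C_k, η_k)` of the construction: `C_1 = K ⊕ HY^2(D, D)'` with the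
universal infinitesimal deformation `η_1`, and `C_{k+1}` is obtained from `(C_k, η_k)` as above, with
a deformation `η_{k+1}` which extends `η_k`, i.e. whose push-out along `p_{k+1}` is `η_k`. The
sections `μ` which choose a cocycle in every class are arbitrary. -/
inductive IsStage {K : Type u} {D : Type v} [Field K] [AddCommGroup D] [Module K D]
    (S : Dialgebra K D) [FiniteDimensional K (HY2 S)] :
    ℕ → ∀ (C : Type (max u v)) [CommRing C] [Algebra K C] (ε : C →ₐ[K] K),
      Deformation S C ε → Prop
  | one (μ : HY2 S →ₗ[K] ZY2 S) (hμ : ∀ α, HY2.mk S (μ α) = α) :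
      IsStage S 1 (InfBase S) (infAug S) (universalInfinitesimal μ)
  | succ {k : ℕ} {C : Type (max u v)} [CommRing C] [Algebra K C] {ε : C →ₐ[K] K}
      {η : Deformation S C ε} (h : IsStage S k C ε η)
      (μ : HarrH2 ε →ₗ[K] harrZ2 ε K) (hμ : ∀ α, HarrH2.mk ε (μ α) = α)
      (η' : Deformation S (NextBase η μ) (nextAug η μ))
      (hη' : η'.pushout (nextProj η μ) (fun _ => rfl) = η) :
      IsStage S (k + 1) (NextBase η μ) (nextAug η μ) η'

end DialgDef

end

open DialgDef

namespace DialgDef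

/-! The map `C_{k+1} → C_k` is a small extension. Its kernel `(ker ω_k)'` is finite dimensional, and
an element `b` of `C_{k+1}` acts on it by the scalar `ε(b)`. Take a basis `α_j` of `ker ω_k`, the
dual basis `e_j` of the kernel, and the linear section `q`. Then `q(a) q(b)` has `e_j`-coordinate
`μ(α_j)(a, b)`. Every question about products on `C_{k+1} ⊗ D` over given products on `C_k ⊗ D` thus
splits into one question per `j`. In each of them only the undeformed products of `D` act on the
`e_j`-component, because `e_j` times the maximal ideal is zero. The structure `SmallExtension`
records exactly this data.

Exactness rests on the duality `coker ω' = (ker ω)'`. Evaluation at a class of `ker ω` kills the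
image of `ω'`, so it descends to `C_{k+1}`, where it separates the elements of the kernel. Locality
follows because the kernel has square zero.

Existence: lift the products of `η_k` along `q` and add `∑ e_j ⊗ g_j` for 2-cochains `g_j`. The
`e_j`-coordinate of the axiom defect is the obstruction cochain of `μ(α_j)` plus `δ g_j`
(`axiomDefect_liftOp`). Since `ω_k(α_j) = 0`, that obstruction cochain is a coboundary, and a
suitable `g_j` cancels it.

Uniqueness: two extensions of `η_k` differ by `∑ e_j ⊗ z_j`, where the `z_j` are 2-cocycles of `D`
(`diffCochain_mem`). There are two ways to change `z_j`. An equivalence `1 + ∑ e_j ⊗ G_j` changes it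
by the coboundary of `G_j`. An automorphism `b ↦ b + ∑ h_j(p b) e_j`, with `h_j` a derivation of
`C_k` into `K`, changes it by the 2-cochain `(h_j ⊗ id) ∘ η_k`. Hence it suffices that the
differential of `η_k`, from `Der(C_k, K)` to `HY^2(D, D)`, is onto (`DifferentialSurjective`). For
`k = 1` this holds because evaluation at a class is a derivation of `C_1` whose cochain represents
that class. It passes from `C_k` to `C_{k+1}` because a derivation composed with `p_{k+1}` is again
a derivation and has the same cochain. -/

/-- A surjection `p : B → A` of augmented algebras whose kernel has the finite basis `e` and is
annihilated by the augmentation ideal of `B`, with a linear section `q` of `p` and coordinate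
functions on the kernel. -/
structure SmallExtension {K A B : Type*} [Field K] [CommRing A] [Algebra K A] [CommRing B]
    [Algebra K B] (p : B →ₐ[K] A) (ε : A →ₐ[K] K) (εB : B →ₐ[K] K) (n : ℕ) where
  e : Fin n → B
  coord : Fin n → B →ₗ[K] K
  q : A →ₗ[K] B
  aug : ∀ b, ε (p b) = εB b
  proj_e : ∀ j, p (e j) = 0
  proj_q : ∀ a, p (q a) = a
  mul_e : ∀ b j, b * e j = εB b • e j
  coord_e : ∀ j k, coord j (e k) = if k = j then 1 else 0
  coord_q : ∀ j a, coord j (q a) = 0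
  decomp : ∀ b, b = q (p b) + ∑ j, coord j b • e j

/-! ### Tensor calculus over a small extension. -/

namespace SmallExtension

variable {K : Type u} {D : Type v} [Field K] [AddCommGroup D] [Module K D] {S : Dialgebra K D}
  {A : Type*} [CommRing A] [Algebra K A] {B : Type*} [CommRing B] [Algebra K B]
  {p : B →ₐ[K] A} {ε : A →ₐ[K] K} {εB : B →ₐ[K] K} {n : ℕ}

theorem aug_e (X : SmallExtension p ε εB n) (j : Fin n) : εB (X.e j) = 0 := by
  rw [← X.aug, X.proj_e, map_zero]

theorem aug_q (X : SmallExtension p ε εB n) (a : A) : εB (X.q a) = ε a := by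
  rw [← X.aug, X.proj_q]

/-- The map `d ↦ ∑ e_j ⊗ d_j`. -/
noncomputable def incl (X : SmallExtension p ε εB n) : (Fin n → D) →ₗ[K] B ⊗[K] D :=
  ∑ j, TensorProduct.mk K B D (X.e j) ∘ₗ LinearMap.proj j

theorem incl_apply (X : SmallExtension p ε εB n) (d : Fin n → D) :
    X.incl d = ∑ j, X.e j ⊗ₜ[K] d j := by
  simp [incl]

/-- The kernel is annihilated by the augmentation ideal, so multiplication by `e_j` only sees the
reduction of `w` modulo that ideal. All the first-order behaviour below comes from this. -/
theorem e_smul (X : SmallExtension p ε εB n) (j : Fin n) (w : B ⊗[K] D) :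
    X.e j • w = X.e j ⊗ₜ[K] contract D εB.toLinearMap w := by
  induction w using TensorProduct.induction_on with
  | zero => simp
  | tmul b x =>
    rw [contract_tmul, TensorProduct.smul_tmul', smul_eq_mul, mul_comm, X.mul_e,
      TensorProduct.smul_tmul]
    rfl
  | add u v hu hv => rw [smul_add, hu, hv, map_add, TensorProduct.tmul_add]

theorem smul_incl (X : SmallExtension p ε εB n) (b : B) (d : Fin n → D) :
    b • X.incl d = X.incl (εB b • d) := by
  simp only [incl_apply, Finset.smul_sum, TensorProduct.smul_tmul', smul_eq_mul, X.mul_e,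
    Pi.smul_apply, TensorProduct.smul_tmul]

theorem contract_aug_incl (X : SmallExtension p ε εB n) (d : Fin n → D) :
    contract D εB.toLinearMap (X.incl d) = 0 := by
  simp [incl_apply, X.aug_e]

theorem contract_coord_incl (X : SmallExtension p ε εB n) (j : Fin n) (d : Fin n → D) :
    contract D (X.coord j) (X.incl d) = d j := by
  simp [incl_apply, X.coord_e]

theorem rTensor_incl (X : SmallExtension p ε εB n) (d : Fin n → D) :
    p.toLinearMap.rTensor D (X.incl d) = 0 := by
  simp [incl_apply, X.proj_e]

theorem rTensor_proj_q (X : SmallExtension p ε εB n) (u : A ⊗[K] D) :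
    p.toLinearMap.rTensor D (X.q.rTensor D u) = u := by
  induction u using TensorProduct.induction_on with
  | zero => simp
  | tmul a d => simp [X.proj_q]
  | add u v hu hv => simp only [map_add, hu, hv]

theorem contract_coord_q (X : SmallExtension p ε εB n) (j : Fin n) (u : A ⊗[K] D) :
    contract D (X.coord j) (X.q.rTensor D u) = 0 := by
  induction u using TensorProduct.induction_on with
  | zero => simp
  | tmul a d => simp [X.coord_q]
  | add u v hu hv => simp only [map_add, hu, hv, add_zero]

/-- The splitting `B = q(A) ⊕ ⨁ K e_j`, tensored with `D`. It allows equations in `B ⊗ D` to be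
checked after `p ⊗ id` and on each coordinate. -/
theorem tensor_decomp (X : SmallExtension p ε εB n) (w : B ⊗[K] D) :
    w = X.q.rTensor D (p.toLinearMap.rTensor D w) +
      X.incl fun j => contract D (X.coord j) w := by
  induction w using TensorProduct.induction_on with
  | zero =>
    simp only [map_zero, zero_add]
    exact (map_zero X.incl).symm
  | tmul b x =>
    conv_lhs => rw [X.decomp b]
    simp [incl_apply, TensorProduct.add_tmul, TensorProduct.sum_tmul, TensorProduct.smul_tmul]
  | add u v hu hv =>
    conv_lhs => rw [hu, hv]
    have : (fun j => contract D (X.coord j) (u + v)) =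
      (fun j => contract D (X.coord j) u) + fun j => contract D (X.coord j) v := by
      ext j; simp
    rw [this, map_add, map_add, map_add]
    abel

theorem eq_incl (X : SmallExtension p ε εB n) {w : B ⊗[K] D}
    (h : p.toLinearMap.rTensor D w = 0) : w = X.incl fun j => contract D (X.coord j) w := by
  conv_lhs => rw [X.tensor_decomp w, h, map_zero, zero_add]

/-! ### Bilinear products and the kernel. -/

section Products

variable {m m' : B ⊗[K] D →ₗ[B] B ⊗[K] D →ₗ[B] B ⊗[K] D} {o : D →ₗ[K] D →ₗ[K] D}

/-- By bilinearity `e_j` comes out of the product and then reduces it modulo the augmentation ideal,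
so any product lifting `o` acts on the kernel part through `o` alone. -/
theorem bilin_incl_right (X : SmallExtension p ε εB n)
    (hm : ∀ u v, contract D εB.toLinearMap (m u v) =
      o (contract D εB.toLinearMap u) (contract D εB.toLinearMap v))
    (u : B ⊗[K] D) (d : Fin n → D) :
    m u (X.incl d) = X.incl fun j => o (contract D εB.toLinearMap u) (d j) := by
  simp only [incl_apply, map_sum]
  refine Finset.sum_congr rfl fun j _ => ?_
  rw [tmul_eq_smul, map_smul, X.e_smul, hm]
  simp

theorem bilin_incl_left (X : SmallExtension p ε εB n)
    (hm : ∀ u v, contract D εB.toLinearMap (m u v) =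
      o (contract D εB.toLinearMap u) (contract D εB.toLinearMap v))
    (d : Fin n → D) (v : B ⊗[K] D) :
    m (X.incl d) v = X.incl fun j => o (d j) (contract D εB.toLinearMap v) := by
  simp only [incl_apply, map_sum, LinearMap.sum_apply]
  refine Finset.sum_congr rfl fun j _ => ?_
  rw [tmul_eq_smul, map_smul, LinearMap.smul_apply, X.e_smul, hm]
  simp

/-- If two products on `B ⊗ D` differ on `D` by `∑ e_j ⊗ c_j`, so they do on `B ⊗ D`. -/
theorem bilin_eq_add_incl (X : SmallExtension p ε εB n) (c : Fin n → D →ₗ[K] D →ₗ[K] D)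
    (h : ∀ x y, m' (1 ⊗ₜ x) (1 ⊗ₜ y) = m (1 ⊗ₜ x) (1 ⊗ₜ y) + X.incl fun j => c j x y)
    (u v : B ⊗[K] D) :
    m' u v = m u v +
      X.incl fun j => c j (contract D εB.toLinearMap u) (contract D εB.toLinearMap v) := by
  induction u using TensorProduct.induction_on with
  | zero =>
    simp only [map_zero, LinearMap.zero_apply, zero_add]
    exact (map_zero X.incl).symm
  | add u u' hu hu' =>
    have : (fun j => c j (contract D εB.toLinearMap (u + u')) (contract D εB.toLinearMap v)) =
      (fun j => c j (contract D εB.toLinearMap u) (contract D εB.toLinearMap v)) +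
      fun j => c j (contract D εB.toLinearMap u') (contract D εB.toLinearMap v) := by
      ext j; simp
    rw [this, map_add, map_add, LinearMap.add_apply, LinearMap.add_apply, map_add, hu, hu']
    abel
  | tmul s x =>
    induction v using TensorProduct.induction_on with
    | zero =>
      simp only [map_zero, zero_add]
      exact (map_zero X.incl).symm
    | add v v' hv hv' =>
      have : (fun j => c j (contract D εB.toLinearMap (s ⊗ₜ x))
            (contract D εB.toLinearMap (v + v'))) =
          (fun j => c j (contract D εB.toLinearMap (s ⊗ₜ x)) (contract D εB.toLinearMap v)) +
          fun j => c j (contract D εB.toLinearMap (s ⊗ₜ x)) (contract D εB.toLinearMap v') := by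
        ext j; simp
      rw [this, map_add, map_add, map_add, hv, hv']
      abel
    | tmul t y =>
      -- The scalars `s` and `t` act on the correction term through `εB`, which is how they enter
      -- the contracted arguments of `c j`.
      rw [tmul_eq_smul s x, tmul_eq_smul t y]
      simp only [map_smul, LinearMap.smul_apply, h, smul_add, X.smul_incl, contract_smul,
        contract_tmul, AlgHom.toLinearMap_apply, map_one, one_smul]
      congr 1
      rw [← map_smul X.incl, X.smul_incl]
      rfl

end Products

end SmallExtension

/-! ### Cochains on small trees, and derivations as Harrison 1-cocycles. -/

/-- The coboundary of a `1`-cochain: the three faces of a `2`-tree agree, and so do its three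
products. -/
theorem delta1_apply_sideTree {K : Type u} {D : Type v} [Field K] [AddCommGroup D] [Module K D]
    (S : Dialgebra K D) (f : CY1 K D) (s : Side) (a b : D) :
    delta1 S f (sideTree s) a b =
      S.op s a (f ⟨.node () .nil .nil, rfl⟩ b) - f ⟨.node () .nil .nil, rfl⟩ (S.op s a b) +
        S.op s (f ⟨.node () .nil .nil, rfl⟩ a) b := by
  have hY : ∀ y : Y 1, y = ⟨.node () .nil .nil, rfl⟩ := fun y => Subtype.ext (tree_one y.1 y.2)
  have h : ∀ i : Fin 3, circ i (sideTree s) = s := by cases s <;> decide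
  rw [delta1_apply, hY (face 0 _), hY (face 1 _), hY (face 2 _), h 0, h 1, h 2]

theorem prodSide_sideTree (s : Side) : prodSide (sideTree s) = s := by
  cases s <;> decide

theorem Deformation.op_injective {K : Type u} {D : Type v} [Field K] [AddCommGroup D] [Module K D]
    {S : Dialgebra K D} {A : Type*} [CommRing A] [Algebra K A] {ε : A →ₐ[K] K}
    {η η' : Deformation S A ε} (h : η.op = η'.op) : η = η' :=
  Deformation.ext (congrFun h .left) (congrFun h .right)

/-- The kernel of `harrD1` consists of the derivations of `A` into `K` along `ε`. This lemma and the
next supply unitality and multiplicativity of the automorphisms built from them. -/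
theorem map_one_of_harrD1_eq_zero {K : Type u} [Field K] {A : Type*} [CommRing A] [Algebra K A]
    {ε : A →ₐ[K] K} {h : A →ₗ[K] K} (hh : harrD1 ε K h = 0) : h 1 = 0 := by
  have := LinearMap.congr_fun (LinearMap.congr_fun hh 1) 1
  simpa [harrD1_apply] using this

theorem map_mul_of_harrD1_eq_zero {K : Type u} [Field K] {A : Type*} [CommRing A] [Algebra K A]
    {ε : A →ₐ[K] K} {h : A →ₗ[K] K} (hh : harrD1 ε K h = 0) (a b : A) :
    h (a * b) = ε a * h b + ε b * h a := by
  have := LinearMap.congr_fun (LinearMap.congr_fun hh a) b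
  rw [harrD1_apply, LinearMap.zero_apply, LinearMap.zero_apply, smul_eq_mul, smul_eq_mul] at this
  linear_combination -this

/-! ### Cochains of a push-out. -/

section Pushout

variable {K : Type u} {D : Type v} [Field K] [AddCommGroup D] [Module K D] {S : Dialgebra K D}
  {A : Type*} [CommRing A] [Algebra K A] {B : Type*} [CommRing B] [Algebra K B]
  {ε : A →ₐ[K] K} {εB : B →ₐ[K] K} {p : B →ₐ[K] A}

theorem Deformation.pushout_op_one (hp : ∀ b, ε (p b) = εB b) (η : Deformation S B εB) (s : Side)
    (x y : D) : (η.pushout p hp).op s (1 ⊗ₜ x) (1 ⊗ₜ y) =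
      p.toLinearMap.rTensor D (η.op s (1 ⊗ₜ x) (1 ⊗ₜ y)) := by
  rw [Deformation.pushout_op, pushBilin_tmul, one_mul, one_smul]

theorem contract_comp (h : A →ₗ[K] K) (w : B ⊗[K] D) :
    contract D (h ∘ₗ p.toLinearMap) w = contract D h (p.toLinearMap.rTensor D w) := by
  simp [contract, LinearMap.rTensor_comp]

/-- This has two uses: the automorphism of `B` given by derivations of `A` shifts a deformation by
cochains that depend only on its push-out to `A`, and pulling a derivation back along `p` leaves its
cochain unchanged. -/
theorem defCochain_pushout (hp : ∀ b, ε (p b) = εB b) (η : Deformation S B εB) (h : A →ₗ[K] K) :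
    defCochain (η.pushout p hp) h = defCochain η (h ∘ₗ p.toLinearMap) := by
  funext y
  refine LinearMap.ext₂ fun a b => ?_
  rw [defCochain_apply, defCochain_apply, Deformation.pushout_op_one, contract_comp]

end Pushout

namespace SmallExtension

variable {K : Type u} {D : Type v} [Field K] [AddCommGroup D] [Module K D] {S : Dialgebra K D}
  {A : Type*} [CommRing A] [Algebra K A] {B : Type*} [CommRing B] [Algebra K B]
  {p : B →ₐ[K] A} {ε : A →ₐ[K] K} {εB : B →ₐ[K] K} {n : ℕ}

/-! ### Automorphisms -/

section Automorphism

variable (X : SmallExtension p ε εB n) (h : Fin n → A →ₗ[K] K)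

/-- The endomorphism `b ↦ b + ∑ h_j(p(b)) e_j` of the extension, for derivations `h_j`. -/
noncomputable def autHom (hh : ∀ j, harrD1 ε K (h j) = 0) : B →ₐ[K] B :=
  AlgHom.ofLinearMap
    (LinearMap.id + ∑ j, (h j ∘ₗ p.toLinearMap).smulRight (X.e j))
    (by simp [map_one_of_harrD1_eq_zero (hh _)])
    (fun a b => by
      -- The kernel has square zero, so the quadratic terms vanish. What remains is the Leibniz rule
      -- for each `h j`, since `b * e_j = εB(b) e_j`.
      have he : ∀ j k, X.e j * X.e k = 0 := fun j k => by rw [X.mul_e, X.aug_e, zero_smul]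
      simp only [LinearMap.add_apply, LinearMap.id_apply, LinearMap.sum_apply,
        LinearMap.smulRight_apply, LinearMap.comp_apply, AlgHom.toLinearMap_apply, map_mul,
        map_mul_of_harrD1_eq_zero (hh _), X.aug]
      rw [add_mul, mul_add, mul_add, add_assoc, Finset.mul_sum, Finset.sum_mul,
        Finset.sum_mul_sum]
      simp only [smul_mul_smul_comm, he, smul_zero, Finset.sum_const_zero, add_zero]
      rw [← Finset.sum_add_distrib]
      refine congrArg _ (Finset.sum_congr rfl fun j _ => ?_)
      rw [mul_smul_comm, smul_mul_assoc, mul_comm (X.e j) b, X.mul_e, X.mul_e, smul_smul, smul_smul,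
        ← add_smul]
      congr 1
      ring)

theorem autHom_apply (hh : ∀ j, harrD1 ε K (h j) = 0) (b : B) :
    X.autHom h hh b = b + ∑ j, h j (p b) • X.e j := by
  simp [autHom]

theorem proj_autHom (hh : ∀ j, harrD1 ε K (h j) = 0) (b : B) : p (X.autHom h hh b) = p b := by
  simp [autHom_apply, X.proj_e]

theorem autHom_eq_self (hh : ∀ j, harrD1 ε K (h j) = 0) {b : B} (hb : p b = 0) :
    X.autHom h hh b = b := by
  simp [autHom_apply, hb]

/-- The automorphism `b ↦ b + ∑ h_j(p(b)) e_j` of the extension, for derivations `h_j`. -/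
noncomputable def aut (hh : ∀ j, harrD1 ε K (h j) = 0) : B ≃ₐ[K] B :=
  AlgEquiv.ofAlgHom (X.autHom h hh) (X.autHom (-h) fun j => by simp [hh])
    (by ext b; simp [autHom_apply, X.proj_e])
    (by ext b; simp [autHom_apply, X.proj_e])

theorem rTensor_aut (hh : ∀ j, harrD1 ε K (h j) = 0) (w : B ⊗[K] D) :
    (X.aut h hh).toAlgHom.toLinearMap.rTensor D w =
      w + X.incl fun j => contract D (h j ∘ₗ p.toLinearMap) w := by
  induction w using TensorProduct.induction_on with
  | zero =>
    simp only [map_zero, zero_add]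
    exact (map_zero X.incl).symm
  | tmul b x =>
    have : (X.aut h hh).toAlgHom.toLinearMap b = b + ∑ j, h j (p b) • X.e j :=
      X.autHom_apply h hh b
    rw [LinearMap.rTensor_tmul, this]
    simp [incl_apply, TensorProduct.add_tmul, TensorProduct.sum_tmul, TensorProduct.smul_tmul]
  | add u v hu hv =>
    have : (fun j => contract D (h j ∘ₗ p.toLinearMap) (u + v)) =
      (fun j => contract D (h j ∘ₗ p.toLinearMap) u) +
        fun j => contract D (h j ∘ₗ p.toLinearMap) v := by
      ext j; simp
    rw [this, map_add, map_add, hu, hv]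
    abel

end Automorphism

/-- The automorphism `u ↦ u + ∑ e_j ⊗ G_j(u)` of the `B`-module `B ⊗ D`. -/
noncomputable def shear (X : SmallExtension p ε εB n) (G : Fin n → D →ₗ[K] D) :
    B ⊗[K] D ≃ₗ[B] B ⊗[K] D where
  toFun u := u + X.incl fun j => G j (contract D εB.toLinearMap u)
  invFun u := u - X.incl fun j => G j (contract D εB.toLinearMap u)
  map_add' u v := by
    have : (fun j => G j (contract D εB.toLinearMap (u + v))) =
      (fun j => G j (contract D εB.toLinearMap u)) +
        fun j => G j (contract D εB.toLinearMap v) := by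
      ext j; simp
    rw [this, map_add]
    abel
  -- Linearity over `B`, and not only over `K`, holds because `B` acts through `εB` both on the
  -- kernel part and on the contraction.
  map_smul' b u := by
    rw [RingHom.id_apply, smul_add, X.smul_incl, contract_smul]
    congr 2
    ext j
    simp
  left_inv u := by
    simp only [map_add, X.contract_aug_incl, add_zero, add_sub_cancel_right]
  right_inv u := by
    simp only [map_sub, X.contract_aug_incl, sub_zero, sub_add_cancel]

theorem shear_apply (X : SmallExtension p ε εB n) (G : Fin n → D →ₗ[K] D) (u : B ⊗[K] D) :
    X.shear G u = u + X.incl fun j => G j (contract D εB.toLinearMap u) := rfl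

/-! ### Uniqueness of extensions of deformations -/

section Uniqueness

variable (X : SmallExtension p ε εB n) (η' η'' : Deformation S B εB)

/-- The coordinates of the difference of two deformations over the same deformation. -/
noncomputable def diffCochain (j : Fin n) : CY2 K D :=
  defCochain η'' (X.coord j) - defCochain η' (X.coord j)

variable {η' η''}

/-- Equal push-outs force the difference on `1 ⊗ x`, `1 ⊗ y` into the kernel of `p ⊗ id`, where it
is determined by its coordinates. Bilinearity then gives all of `B ⊗ D`. -/
theorem op_eq_add_diffCochain (h : η'.pushout p X.aug = η''.pushout p X.aug) (s : Side)
    (u v : B ⊗[K] D) :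
    η''.op s u v = η'.op s u v + X.incl fun j => X.diffCochain η' η'' j (sideTree s)
      (contract D εB.toLinearMap u) (contract D εB.toLinearMap v) := by
  refine X.bilin_eq_add_incl (fun j => X.diffCochain η' η'' j (sideTree s)) (fun x y => ?_) u v
  rw [← sub_eq_iff_eq_add', X.eq_incl (w := η''.op s _ _ - η'.op s _ _)]
  · refine congrArg X.incl (funext fun j => ?_)
    simp only [diffCochain, Pi.sub_apply, LinearMap.sub_apply, defCochain_apply, prodSide_sideTree,
      map_sub]
  · rw [map_sub, ← Deformation.pushout_op_one X.aug, ← Deformation.pushout_op_one X.aug, h, sub_self]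

/-- Expand the axioms of `η''` around those of `η'`. The differences enter only linearly, since a
product with a kernel term is undeformed, and the `e_j`-coordinate of the linear part is `delta2`.
-/
theorem diffCochain_mem (h : η'.pushout p X.aug = η''.pushout p X.aug) (j : Fin n) :
    X.diffCochain η' η'' j ∈ ZY2 S := by
  rw [LinearMap.mem_ker]
  funext y
  refine LinearMap.ext fun a => LinearMap.ext₂ fun b c => ?_
  have h' := LinearMap.congr_fun (LinearMap.congr_fun (LinearMap.congr_fun
    (η'.toDialgebra.axiomDefect_eq_zero y) (1 ⊗ₜ a)) (1 ⊗ₜ b)) (1 ⊗ₜ c)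
  have h'' := LinearMap.congr_fun (LinearMap.congr_fun (LinearMap.congr_fun
    (η''.toDialgebra.axiomDefect_eq_zero y) (1 ⊗ₜ a)) (1 ⊗ₜ b)) (1 ⊗ₜ c)
  rw [axiomDefect_apply] at h' h''
  rw [X.op_eq_add_diffCochain h (circ 2 y), X.op_eq_add_diffCochain h (circ 1 y), map_add, map_add,
    LinearMap.add_apply, X.bilin_incl_right (η''.aug_op _), X.bilin_incl_left (η''.aug_op _),
    X.op_eq_add_diffCochain h (circ 0 y), X.op_eq_add_diffCochain h (circ 3 y),
    sub_eq_zero.1 h', η'.aug_op, η'.aug_op] at h''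
  have hj := congrArg (contract D (X.coord j)) h''
  obtain ⟨h0, h1, h2, h3⟩ := prodSide_face y
  have e0 := sideTree_prodSide (face 0 y)
  have e1 := sideTree_prodSide (face 1 y)
  have e2 := sideTree_prodSide (face 2 y)
  have e3 := sideTree_prodSide (face 3 y)
  rw [h0] at e0
  rw [h1] at e1
  rw [h2] at e2
  rw [h3] at e3
  simp only [map_sub, map_add, X.contract_coord_incl, LinearMap.zero_apply, map_zero, contract_tmul,
    AlgHom.toLinearMap_apply, map_one, one_smul, e0, e1, e2, e3] at hj
  rw [delta2_apply]
  refine Eq.trans ?_ hj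
  abel

/-- If every `2`-cocycle of `S` is cohomologous to the cochain of `η` belonging to a derivation of
`A`, then two extensions of `η` to `B` are equivalent up to an automorphism of `B` over `A`. -/
theorem exists_aut_equivalent {η : Deformation S A ε}
    (hη : ∀ z ∈ ZY2 S, ∃ h : A →ₗ[K] K, harrD1 ε K h = 0 ∧
      defCochain η h - z ∈ LinearMap.range (delta1 S))
    (h' : η'.pushout p X.aug = η) (h'' : η''.pushout p X.aug = η) :
    ∃ (r : B ≃ₐ[K] B) (hr : ∀ b, p (r b) = p b), (∀ b, p b = 0 → r b = b) ∧
      (η'.pushout r.toAlgHom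
        (fun b => (X.aug _).symm.trans ((congrArg ε (hr b)).trans (X.aug b)))).Equivalent η'' := by
  have heq : η'.pushout p X.aug = η''.pushout p X.aug := h'.trans h''.symm
  -- For each coordinate: the derivation `h j` yields the automorphism, and the 1-cochain `g j`
  -- accounts for the remaining coboundary and yields the equivalence.
  choose h hh g hg using fun j => hη _ (X.diffCochain_mem heq j)
  have hr : ∀ b, p (X.aut h hh b) = p b := X.proj_autHom h hh
  refine ⟨X.aut h hh, hr, fun b hb => X.autHom_eq_self h hh hb, ?_⟩
  have haug : ∀ b, εB ((X.aut h hh).toAlgHom b) = εB b := fun b =>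
    (X.aug _).symm.trans ((congrArg ε (hr b)).trans (X.aug b))
  -- There is only one 1-tree, so a 1-cochain is a single endomorphism of `D`.
  set G : Fin n → D →ₗ[K] D := fun j => g j ⟨.node () .nil .nil, rfl⟩ with hG
  have key : ∀ s u v, X.shear G ((η'.pushout (X.aut h hh).toAlgHom haug).op s u v) =
      η''.op s (X.shear G u) (X.shear G v) := by
    intro s u v
    -- The automorphism adds `∑ e_j ⊗ (h_j ⊗ id)` of the product pushed down to `A`, and that
    -- product is the one of `η`.
    have hop := X.bilin_eq_add_incl (m := η'.op s)
      (m' := (η'.pushout (X.aut h hh).toAlgHom haug).op s)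
      (fun j => defCochain η (h j) (sideTree s)) (fun x y => by
        rw [Deformation.pushout_op_one, X.rTensor_aut]
        subst h'
        simp only [defCochain_pushout, defCochain_apply, prodSide_sideTree]) u v
    rw [shear_apply, Deformation.aug_op, hop, shear_apply, shear_apply, map_add, map_add,
      LinearMap.add_apply, X.bilin_incl_left (η''.aug_op _), LinearMap.add_apply,
      X.bilin_incl_right (η''.aug_op _), X.bilin_incl_left (η''.aug_op _), X.op_eq_add_diffCochain heq,
      X.contract_aug_incl]
    simp only [map_zero]
    -- All kernel terms on either side are collected into one `X.incl`. Coordinate by coordinate,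
    -- the identity to prove is then `hg j` evaluated at the reductions of `u` and `v`.
    rw [add_assoc, add_assoc, add_assoc, ← map_add, ← map_add, ← map_add, ← map_add]
    refine congrArg (_ + ·) (congrArg X.incl (funext fun j => ?_))
    have hj := LinearMap.congr_fun (LinearMap.congr_fun (congrFun (hg j) (sideTree s))
      (contract D εB.toLinearMap u)) (contract D εB.toLinearMap v)
    rw [delta1_apply_sideTree, Pi.sub_apply, LinearMap.sub_apply, LinearMap.sub_apply,
      eq_sub_iff_add_eq] at hj
    simp only [Pi.add_apply, hG, ← hj]
    abel
  refine ⟨X.shear G, key .left, key .right, fun u => ?_⟩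
  rw [shear_apply, map_add, X.contract_aug_incl, add_zero]

end Uniqueness

end SmallExtension

namespace SmallExtension

variable {K : Type u} {D : Type v} [Field K] [AddCommGroup D] [Module K D] {S : Dialgebra K D}
  {A : Type*} [CommRing A] [Algebra K A] {B : Type*} [CommRing B] [Algebra K B]
  {p : B →ₐ[K] A} {ε : A →ₐ[K] K} {εB : B →ₐ[K] K} {n : ℕ}

/-! ### Existence of extensions of deformations -/

section Existence

variable (X : SmallExtension p ε εB n) (η : Deformation S A ε) (g : Fin n → CY2 K D)

/-- The lift to `B ⊗ D` of the products of `η` along the section `q`, corrected by the cochains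
`g_j`. -/
noncomputable def liftOp (s : Side) : B ⊗[K] D →ₗ[B] B ⊗[K] D →ₗ[B] B ⊗[K] D :=
  extendBilin (LinearMap.mk₂ K
      (fun x y => X.q.rTensor D (η.op s (1 ⊗ₜ x) (1 ⊗ₜ y)))
      (fun x x' y => by simp [TensorProduct.tmul_add])
      (fun r x y => by
        rw [TensorProduct.tmul_smul, LinearMap.map_smul_of_tower, LinearMap.smul_apply, map_smul])
      (fun x y y' => by simp [TensorProduct.tmul_add])
      (fun r x y => by rw [TensorProduct.tmul_smul, LinearMap.map_smul_of_tower, map_smul]) +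
    ∑ j, (g j (sideTree s)).compr₂ (TensorProduct.mk K B D (X.e j)))

theorem liftOp_tmul (s : Side) (b b' : B) (x y : D) :
    X.liftOp η g s (b ⊗ₜ x) (b' ⊗ₜ y) = (b * b') •
      (X.q.rTensor D (η.op s (1 ⊗ₜ x) (1 ⊗ₜ y)) + X.incl fun j => g j (sideTree s) x y) := by
  rw [liftOp, extendBilin_tmul]
  simp [incl_apply, LinearMap.sum_apply]

/-- Since `q` is a section and the correction lies in the kernel, the lift covers the product of `η`
whatever the `g j` are. -/
theorem rTensor_liftOp (s : Side) (u v : B ⊗[K] D) :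
    p.toLinearMap.rTensor D (X.liftOp η g s u v) =
      η.op s (p.toLinearMap.rTensor D u) (p.toLinearMap.rTensor D v) := by
  induction u using TensorProduct.induction_on with
  | zero => simp
  | add u u' hu hu' => simp only [map_add, LinearMap.add_apply, hu, hu']
  | tmul b x =>
    induction v using TensorProduct.induction_on with
    | zero => simp
    | add v v' hv hv' => simp only [map_add, hv, hv']
    | tmul b' y =>
      rw [liftOp_tmul, tensor_smul_rTensor, map_add, X.rTensor_proj_q, X.rTensor_incl, add_zero,
        LinearMap.rTensor_tmul, LinearMap.rTensor_tmul, tmul_eq_smul (p.toLinearMap b) x,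
        tmul_eq_smul (p.toLinearMap b') y]
      simp only [map_smul, LinearMap.smul_apply, map_mul, mul_smul, AlgHom.toLinearMap_apply]
      rw [smul_comm]

theorem contract_eq_contract_rTensor (w : B ⊗[K] D) (X : SmallExtension p ε εB n) :
    contract D εB.toLinearMap w = contract D ε.toLinearMap (p.toLinearMap.rTensor D w) :=
  (contract_rTensor p X.aug w).symm

theorem aug_liftOp (s : Side) (u v : B ⊗[K] D) :
    contract D εB.toLinearMap (X.liftOp η g s u v) =
      S.op s (contract D εB.toLinearMap u) (contract D εB.toLinearMap v) := by
  simp only [contract_eq_contract_rTensor _ X, rTensor_liftOp, η.aug_op]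

variable {f : Fin n → harrZ2 ε K}

/-- The hypothesis `hf` says that the failure of `q` to be multiplicative is measured by the
Harrison cocycles `f j`. This is the point where they enter the lifted products. -/
theorem contract_coord_q_smul (hf : ∀ j a b, X.coord j (X.q a * X.q b) = (f j).1 a b) (j : Fin n)
    (a : A) (w : A ⊗[K] D) :
    contract D (X.coord j) (X.q a • X.q.rTensor D w) = contract D ((f j).1 a) w := by
  induction w using TensorProduct.induction_on with
  | zero => simp
  | tmul b e => simp [TensorProduct.smul_tmul', hf]
  | add u v hu hv => simp only [map_add, smul_add, hu, hv]

/-- The `e_j`-coordinate has three sources: the non-multiplicativity of `q`, the correction `g j`,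
and the kernel part of `u`, on which the undeformed product acts. -/
theorem coord_liftOp_right (hf : ∀ j a b, X.coord j (X.q a * X.q b) = (f j).1 a b) (s : Side)
    (j : Fin n) (x : D) (u : B ⊗[K] D) :
    contract D (X.coord j) (X.liftOp η g s (1 ⊗ₜ x) u) =
      nest (f j).1 (leftMul (η.op s) x) (p.toLinearMap.rTensor D u) +
        g j (sideTree s) x (contract D εB.toLinearMap u) +
        S.op s x (contract D (X.coord j) u) := by
  have hq : ∀ w : A ⊗[K] D, contract D (X.coord j) (X.liftOp η g s (1 ⊗ₜ x) (X.q.rTensor D w)) =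
      nest (f j).1 (leftMul (η.op s) x) w +
        g j (sideTree s) x (contract D ε.toLinearMap w) := by
    intro w
    induction w using TensorProduct.induction_on with
    | zero => simp
    | add u v hu hv => simp only [map_add, hu, hv]; abel
    | tmul a d =>
      rw [LinearMap.rTensor_tmul, liftOp_tmul, one_mul, smul_add, map_add,
        X.contract_coord_q_smul hf, X.smul_incl, X.contract_coord_incl, X.aug_q]
      simp
  conv_lhs => rw [X.tensor_decomp u]
  rw [map_add, map_add, hq, X.bilin_incl_right (X.aug_liftOp η g s), X.contract_coord_incl,
    ← contract_eq_contract_rTensor _ X]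
  simp

theorem coord_liftOp_left (hf : ∀ j a b, X.coord j (X.q a * X.q b) = (f j).1 a b) (s : Side)
    (j : Fin n) (x : D) (u : B ⊗[K] D) :
    contract D (X.coord j) (X.liftOp η g s u (1 ⊗ₜ x)) =
      nest (f j).1 (rightMul (η.op s) x) (p.toLinearMap.rTensor D u) +
        g j (sideTree s) (contract D εB.toLinearMap u) x +
        S.op s (contract D (X.coord j) u) x := by
  have hq : ∀ w : A ⊗[K] D, contract D (X.coord j) (X.liftOp η g s (X.q.rTensor D w) (1 ⊗ₜ x)) =
      nest (f j).1 (rightMul (η.op s) x) w +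
        g j (sideTree s) (contract D ε.toLinearMap w) x := by
    intro w
    induction w using TensorProduct.induction_on with
    | zero => simp
    | add u v hu hv => simp only [map_add, LinearMap.add_apply, hu, hv]; abel
    | tmul a d =>
      rw [LinearMap.rTensor_tmul, liftOp_tmul, mul_one, smul_add, map_add,
        X.contract_coord_q_smul hf, X.smul_incl, X.contract_coord_incl, X.aug_q]
      simp
  conv_lhs => rw [X.tensor_decomp u]
  rw [map_add, LinearMap.add_apply, map_add, hq, X.bilin_incl_left (X.aug_liftOp η g s),
    X.contract_coord_incl, ← contract_eq_contract_rTensor _ X]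
  simp

/-- The defect lies over the vanishing defect of `η`, hence in the kernel part. Its `j`-th
coordinate is the obstruction cochain of `f j`, written with `nest`, plus `delta2 S (g j)`, so `hg`
makes it vanish. -/
theorem axiomDefect_liftOp (hf : ∀ j a b, X.coord j (X.q a * X.q b) = (f j).1 a b)
    (hg : ∀ j, delta2 S (g j) = -obstrCochain η (f j)) (y : Y 3) :
    axiomDefect (X.liftOp η g) y = 0 := by
  refine trilinear_ext fun a b c => ?_
  simp only [LinearMap.zero_apply]
  have hp : p.toLinearMap.rTensor D
      (axiomDefect (X.liftOp η g) y (1 ⊗ₜ a) (1 ⊗ₜ b) (1 ⊗ₜ c)) = 0 := by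
    rw [axiomDefect_apply, map_sub]
    simp only [rTensor_liftOp, LinearMap.rTensor_tmul, AlgHom.toLinearMap_apply, map_one]
    have hz := LinearMap.congr_fun (LinearMap.congr_fun (LinearMap.congr_fun
      (η.toDialgebra.axiomDefect_eq_zero y) (1 ⊗ₜ a)) (1 ⊗ₜ b)) (1 ⊗ₜ c)
    simpa [axiomDefect_apply] using hz
  rw [X.eq_incl hp]
  refine (congrArg X.incl (funext fun j => ?_)).trans (map_zero X.incl)
  have hj := LinearMap.congr_fun (LinearMap.congr_fun (LinearMap.congr_fun
    (congrFun (hg j) y) a) b) c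
  rw [Pi.neg_apply, LinearMap.neg_apply, LinearMap.neg_apply, LinearMap.neg_apply,
    obstrCochain_eq_nest, delta2_apply] at hj
  obtain ⟨h0, h1, h2, h3⟩ := prodSide_face y
  have e0 := sideTree_prodSide (face 0 y)
  have e1 := sideTree_prodSide (face 1 y)
  have e2 := sideTree_prodSide (face 2 y)
  have e3 := sideTree_prodSide (face 3 y)
  rw [h0] at e0
  rw [h1] at e1
  rw [h2] at e2
  rw [h3] at e3
  have hc : ∀ s (x z : D), contract D (X.coord j) (X.liftOp η g s (1 ⊗ₜ x) (1 ⊗ₜ z)) =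
      g j (sideTree s) x z := by
    intro s x z
    rw [liftOp_tmul, one_mul, one_smul, map_add, X.contract_coord_q, X.contract_coord_incl,
      zero_add]
  rw [axiomDefect_apply, map_sub, X.coord_liftOp_right η g hf, hc, X.coord_liftOp_left η g hf, hc,
    aug_liftOp, aug_liftOp]
  simp only [rTensor_liftOp, LinearMap.rTensor_tmul, AlgHom.toLinearMap_apply, map_one,
    contract_tmul, one_smul, e0, e1, e2, e3, Pi.zero_apply]
  rw [← sub_eq_zero] at hj
  refine Eq.trans ?_ hj
  abel

/-- A deformation extends to `B` if its obstructions vanish. -/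
theorem exists_pushout_eq (hf : ∀ j a b, X.coord j (X.q a * X.q b) = (f j).1 a b)
    (ho : ∀ j, obstrCochain η (f j) ∈ LinearMap.range (delta2 S)) :
    ∃ η' : Deformation S B εB, η'.pushout p X.aug = η := by
  choose g hg using ho
  -- The sign: `g j` bounds the obstruction cochain, so the correction that cancels it is `-g j`.
  let η' : Deformation S B εB := Deformation.ofOp (X.liftOp η fun j => -g j)
    (X.axiomDefect_liftOp η _ hf fun j => by rw [map_neg, hg])
    (fun s x y => by rw [aug_liftOp]; simp)
  have hop : ∀ s, η'.op s = X.liftOp η (fun j => -g j) s := fun s => by cases s <;> rfl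
  refine ⟨η', Deformation.op_injective (funext fun s => ?_)⟩
  ext x y
  change (η'.pushout p X.aug).op s (1 ⊗ₜ x) (1 ⊗ₜ y) = η.op s (1 ⊗ₜ x) (1 ⊗ₜ y)
  rw [Deformation.pushout_op_one, hop, rTensor_liftOp]
  simp

end Existence

end SmallExtension

/-! ### Finiteness and locality -/

instance HarrExt.finiteDimensional {K : Type*} [Field K] {A : Type*} [CommRing A] [Algebra K A]
    {ε : A →ₐ[K] K} {V : Type*} [AddCommGroup V] [Module K V] (f : harrZ2 ε V)
    [FiniteDimensional K A] [FiniteDimensional K V] : FiniteDimensional K (HarrExt f) :=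
  Module.Finite.of_injective ((HarrExt.proj f).toLinearMap.prod (HarrExt.fibMap f))
    fun _ _ h => HarrExt.ext (congrArg Prod.fst h) (congrArg Prod.snd h)

instance Cohom.finiteDimensional {K V : Type*} [Field K] [AddCommGroup V] [Module K V]
    (Z B : Submodule K V) [FiniteDimensional K V] : FiniteDimensional K (Cohom Z B) :=
  Module.Finite.of_surjective (Cohom.mk Z B) (Cohom.mk_surjective Z B)

/-- Such a `p` reflects units: if `b'` lifts the inverse of `p b`, then `b * b' - 1` lies in the
kernel and squares to zero, so `b * b'` is a unit. Locality then descends along the local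
homomorphism. -/
theorem isLocalRing_of_ker_sq_eq_zero {A B : Type*} [CommRing A] [CommRing B] [IsLocalRing A]
    (p : B →+* A) (hp : Function.Surjective p) (h : ∀ x, p x = 0 → x * x = 0) : IsLocalRing B := by
  have : IsLocalHom p := ⟨fun b hb => by
    obtain ⟨a, ha⟩ := hb.exists_right_inv
    obtain ⟨b', rfl⟩ := hp a
    have h0 : (b * b' - 1) * (b * b' - 1) = 0 := h _ (by rw [map_sub, map_mul, ha, map_one, sub_self])
    have hu : IsUnit (b * b') := by
      have := IsNilpotent.isUnit_add_one (r := b * b' - 1) ⟨2, by rw [pow_two, h0]⟩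
      rwa [sub_add_cancel] at this
    exact isUnit_of_mul_isUnit_left hu⟩
  exact RingHom.domain_isLocalRing p

theorem HarrExt.isLocalRing {K : Type*} [Field K] {A : Type*} [CommRing A] [Algebra K A]
    {ε : A →ₐ[K] K} {V : Type*} [AddCommGroup V] [Module K V] (f : harrZ2 ε V) [IsLocalRing A] :
    IsLocalRing (HarrExt f) :=
  isLocalRing_of_ker_sq_eq_zero (HarrExt.proj f).toRingHom (fun a => ⟨HarrExt.split f a, rfl⟩)
    (fun x hx => by
      have : x = HarrExt.incl f x.fib := HarrExt.ext hx rfl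
      rw [this, HarrExt.incl_mul_incl])

/-! ### The extension `C_{k+1}` of `C_k` -/

section NextBase

variable {K : Type u} {D : Type v} [Field K] [AddCommGroup D] [Module K D] {S : Dialgebra K D}
  {C : Type w} [CommRing C] [Algebra K C] {ε : C →ₐ[K] K} (η : Deformation S C ε)
  (μ : HarrH2 ε →ₗ[K] harrZ2 ε K)

theorem nextProj_surjective : Function.Surjective (nextProj η μ) := fun c =>
  ⟨Ideal.Quotient.mk _ (HarrExt.split _ c), rfl⟩

theorem nextProj_mk (x : HarrExt (univCocycle μ)) :
    nextProj η μ (Ideal.Quotient.mk _ x) = x.base := rfl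

theorem nextAug_mk (x : HarrExt (univCocycle μ)) :
    nextAug η μ (Ideal.Quotient.mk _ x) = ε x.base := rfl

theorem exists_restrict_eq (φ : Module.Dual K (LinearMap.ker (obstruction η))) :
    ∃ ψ : Module.Dual K (HarrH2 ε), ψ ∘ₗ (LinearMap.ker (obstruction η)).subtype = φ :=
  φ.exists_extend

/-- The evaluation of the second component at a class in the kernel of the obstruction map. -/
noncomputable def nextEval (α : LinearMap.ker (obstruction η)) : NextBase η μ →ₗ[K] K :=
  ((obstrIdeal η μ).restrictScalars K).liftQ
    (LinearMap.applyₗ α.1 ∘ₗ HarrExt.fibMap (univCocycle μ)) (by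
      -- Evaluating `ω'(χ)` at `α` gives `χ(ω(α))`, which is zero for `α` in `ker ω`.
      rintro _ ⟨χ, rfl⟩
      have : obstruction η α.1 = 0 := α.2
      simp [this]) ∘ₗ
  (Submodule.Quotient.restrictScalarsEquiv K (obstrIdeal η μ)).symm.toLinearMap

theorem nextEval_mk (α : LinearMap.ker (obstruction η)) (x : HarrExt (univCocycle μ)) :
    nextEval η μ α (Ideal.Quotient.mk _ x) = x.fib α.1 := rfl

/-- These evaluations recover a functional from its image in `C_{k+1}`. They give injectivity of
`nextIncl` and serve as the coordinates of `nextExtension`. -/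
theorem nextEval_nextIncl (α : LinearMap.ker (obstruction η))
    (φ : Module.Dual K (LinearMap.ker (obstruction η))) :
    nextEval η μ α (nextIncl η μ φ) = φ α := by
  obtain ⟨ψ, rfl⟩ := exists_restrict_eq η φ
  rw [nextIncl_restrict, nextEval_mk]
  rfl

theorem nextIncl_injective : Function.Injective (nextIncl η μ) := fun φ φ' h =>
  LinearMap.ext fun α => by rw [← nextEval_nextIncl η μ, h, nextEval_nextIncl]

theorem nextProj_nextIncl (φ : Module.Dual K (LinearMap.ker (obstruction η))) :
    nextProj η μ (nextIncl η μ φ) = 0 := by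
  obtain ⟨ψ, rfl⟩ := exists_restrict_eq η φ
  rw [nextIncl_restrict]
  rfl

/-- Modulo the obstruction ideal, only the restriction of the second component to `ker ω` survives.
-/
theorem mk_eq_add_nextIncl (x : HarrExt (univCocycle μ)) :
    Ideal.Quotient.mk (obstrIdeal η μ) x =
      Ideal.Quotient.mk (obstrIdeal η μ) (HarrExt.split _ x.base) +
        nextIncl η μ (x.fib ∘ₗ (LinearMap.ker (obstruction η)).subtype) := by
  rw [nextIncl_restrict, ← map_add]
  congr 1
  ext <;> simp

theorem nextIncl_exact : Function.Exact (nextIncl η μ) (nextProj η μ) := fun b => by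
  refine ⟨fun hb => ?_, ?_⟩
  · obtain ⟨x, rfl⟩ := Ideal.Quotient.mk_surjective b
    rw [nextProj_mk] at hb
    rw [mk_eq_add_nextIncl, hb, map_zero, map_zero, zero_add]
    exact ⟨_, rfl⟩
  · rintro ⟨φ, rfl⟩
    exact nextProj_nextIncl η μ φ

theorem mk_mul_mk_incl (x : HarrExt (univCocycle μ)) (ψ : Module.Dual K (HarrH2 ε)) :
    Ideal.Quotient.mk (obstrIdeal η μ) x *
        Ideal.Quotient.mk (obstrIdeal η μ) (HarrExt.incl (univCocycle μ) ψ) =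
      ε x.base • Ideal.Quotient.mk (obstrIdeal η μ) (HarrExt.incl (univCocycle μ) ψ) := by
  refine (map_mul (Ideal.Quotient.mk (obstrIdeal η μ)) _ _).symm.trans ?_
  rw [HarrExt.mul_incl, map_smul (HarrExt.incl _)]
  rfl

theorem mul_nextIncl (b : NextBase η μ) (φ : Module.Dual K (LinearMap.ker (obstruction η))) :
    b * nextIncl η μ φ = nextAug η μ b • nextIncl η μ φ := by
  obtain ⟨x, rfl⟩ := Ideal.Quotient.mk_surjective b
  obtain ⟨ψ, rfl⟩ := exists_restrict_eq η φ
  rw [nextIncl_restrict, nextAug_mk]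
  exact mk_mul_mk_incl η μ x ψ

/-- `C_{k+1}` as an extension of `C_k`, with the basis of the kernel dual to a basis of
`ker ω_k`. -/
noncomputable def nextExtension [FiniteDimensional K C] :
    SmallExtension (nextProj η μ) ε (nextAug η μ)
      (Module.finrank K (LinearMap.ker (obstruction η))) where
  e j := nextIncl η μ ((Module.finBasis K (LinearMap.ker (obstruction η))).coord j)
  coord j := nextEval η μ (Module.finBasis K (LinearMap.ker (obstruction η)) j)
  q := (Ideal.Quotient.mkₐ K (obstrIdeal η μ)).toLinearMap ∘ₗ HarrExt.split (univCocycle μ)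
  aug _ := rfl
  proj_e _ := nextProj_nextIncl η μ _
  proj_q _ := rfl
  mul_e b j := mul_nextIncl η μ b _
  coord_e j k := by
    rw [nextEval_nextIncl, Module.Basis.coord_apply, Module.Basis.repr_self,
      Finsupp.single_apply]
    simp only [eq_comm]
  coord_q _ _ := rfl
  decomp b := by
    obtain ⟨x, rfl⟩ := Ideal.Quotient.mk_surjective b
    conv_lhs => rw [mk_eq_add_nextIncl]
    refine congrArg (_ + ·) ?_
    simp only [← map_smul, ← map_sum]
    -- Both sides are now functionals on `ker ω`, compared on the chosen basis.
    refine congrArg _ ((Module.finBasis K (LinearMap.ker (obstruction η))).ext fun j => ?_)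
    rw [LinearMap.sum_apply]
    simp [Finsupp.single_apply, nextEval_mk]

theorem nextBase_finiteDimensional [FiniteDimensional K C] : FiniteDimensional K (NextBase η μ) :=
  Module.Finite.of_surjective (Ideal.Quotient.mkₐ K (obstrIdeal η μ)).toLinearMap
    Ideal.Quotient.mk_surjective

theorem nextBase_isLocalRing [IsLocalRing C] : IsLocalRing (NextBase η μ) :=
  isLocalRing_of_ker_sq_eq_zero (nextProj η μ).toRingHom (nextProj_surjective η μ) (fun x hx => by
    obtain ⟨φ, rfl⟩ := (nextIncl_exact η μ x).1 hx
    rw [mul_nextIncl, nextAug, AlgHom.comp_apply, nextProj_nextIncl, map_zero, zero_smul])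

/-- The coordinate cocycles of `nextExtension` are the `μ(α_j)` for a basis `α_j` of `ker ω`.
Dividing by the image of `ω'` keeps precisely the directions in which the obstruction vanishes. -/
theorem exists_next_deformation [FiniteDimensional K C] (hμ : ∀ α, HarrH2.mk ε (μ α) = α) :
    ∃ η' : Deformation S (NextBase η μ) (nextAug η μ),
      η'.pushout (nextProj η μ) (fun _ => rfl) = η := by
  refine (nextExtension η μ).exists_pushout_eq η
    (f := fun j => μ (Module.finBasis K (LinearMap.ker (obstruction η)) j).1)
    (fun j a b => ?_) (fun j => ?_)
  · change nextEval η μ _ (Ideal.Quotient.mk _ (HarrExt.split _ a) *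
      Ideal.Quotient.mk _ (HarrExt.split _ b)) = _
    rw [← map_mul, nextEval_mk]
    simp [univCocycle_apply]
  · have h : obstruction η (Module.finBasis K (LinearMap.ker (obstruction η)) j).1 = 0 :=
      (Module.finBasis K (LinearMap.ker (obstruction η)) j).2
    -- As `μ(α_j)` represents `α_j`, the class `ω(α_j) = 0` is that of the obstruction cochain of
    -- `μ(α_j)`, which is therefore a coboundary.
    rw [← hμ (Module.finBasis K (LinearMap.ker (obstruction η)) j).1, obstruction_mk,
      Cohom.mk_eq_zero_iff] at h
    exact h

end NextBase

/-! ### Derivations of the stages -/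

section Stages

variable {K : Type u} {D : Type v} [Field K] [AddCommGroup D] [Module K D] {S : Dialgebra K D}

/-- Every `2`-cocycle is cohomologous to the cochain of `η` belonging to a derivation of the base:
the differential of `η` is onto `HY^2(D, D)`. -/
def DifferentialSurjective {C : Type w} [CommRing C] [Algebra K C] {ε : C →ₐ[K] K}
    (η : Deformation S C ε) : Prop :=
  ∀ z ∈ ZY2 S, ∃ h : C →ₗ[K] K, harrD1 ε K h = 0 ∧
    defCochain η h - z ∈ LinearMap.range (delta1 S)

/-- A derivation of `A` composed with `p` is a derivation of `B`, since `p` respects the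
augmentations, and it has the same cochain. Enlarging the base therefore loses nothing. -/
theorem DifferentialSurjective.of_pushout {A B : Type*} [CommRing A] [Algebra K A] [CommRing B]
    [Algebra K B] {ε : A →ₐ[K] K} {εB : B →ₐ[K] K} {p : B →ₐ[K] A} (hp : ∀ b, ε (p b) = εB b)
    {η : Deformation S B εB} (h : DifferentialSurjective (η.pushout p hp)) :
    DifferentialSurjective η := fun z hz => by
  obtain ⟨d, hd, hd'⟩ := h z hz
  refine ⟨d ∘ₗ p.toLinearMap, LinearMap.ext₂ fun a b => ?_, defCochain_pushout hp η d ▸ hd'⟩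
  have := LinearMap.congr_fun (LinearMap.congr_fun hd (p a)) (p b)
  simpa [harrD1_apply, hp] using this

theorem contract_homIncl_eval {H : Type*} [AddCommGroup H] [Module K H] {B : Type*} [CommRing B]
    [Algebra K B] (j : Module.Dual K H →ₗ[K] B) [FiniteDimensional K H] {h : B →ₗ[K] K} {α : H}
    (hj : ∀ ξ, h (j ξ) = ξ α) (w : H →ₗ[K] D) : contract D h (homIncl D j w) = w α := by
  induction w using hom_induction with
  | h0 => simp
  | h1 ξ d => rw [homIncl_dualTensorHom, contract_tmul, hj, dualTensorHom_apply]
  | h2 w w' hw hw' => rw [map_add, map_add, hw, hw', LinearMap.add_apply]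

/-- For a cocycle `z` with class `α`, evaluation of the `HY^2(D, D)'`-component at `α` is a
derivation of `C_1`, because that ideal has square zero. Its cochain is `μ(α)`, which is
cohomologous to `z`. -/
theorem differentialSurjective_universalInfinitesimal [FiniteDimensional K (HY2 S)]
    (μ : HY2 S →ₗ[K] ZY2 S) (hμ : ∀ α, HY2.mk S (μ α) = α) :
    DifferentialSurjective (universalInfinitesimal μ) := fun z hz => by
  let α := HY2.mk S ⟨z, hz⟩
  let h : InfBase S →ₗ[K] K := LinearMap.applyₗ α ∘ₗ HarrExt.fibMap (infCocycle S)
  have hx : ∀ x, h x = x.fib α := fun _ => rfl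
  have h0 : (infCocycle S).1 = 0 := rfl
  -- The unit of the extension is `(1, -f(1, 1))`, which is `(1, 0)` for the zero cocycle. Hence `h`
  -- kills the undeformed part `1 ⊗ (a * b)` of the product.
  have h1 : h 1 = 0 := by simp [hx, h0]
  have hd : defCochain (universalInfinitesimal μ) h = (μ α).1 := by
    funext y
    refine LinearMap.ext₂ fun a b => ?_
    rw [defCochain_apply, universalInfinitesimal, sqZeroDeformation_op, sqZeroOp_one, map_add,
      contract_tmul, h1, zero_smul, zero_add, contract_homIncl_eval (α := α) _ (fun ξ => rfl),
      evalCocycle_apply, sideTree_prodSide]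
  refine ⟨h, LinearMap.ext₂ fun a b => ?_, ?_⟩
  · simp [harrD1_apply, hx, h0]
  · rw [hd]
    refine (Cohom.mk_eq_zero_iff (ZY2 S) (LinearMap.range (delta1 S)) (μ α - ⟨z, hz⟩)).1 ?_
    rw [map_sub]
    exact sub_eq_zero.2 (hμ α)

theorem IsStage.finiteDimensional_and_isLocalRing [FiniteDimensional K (HY2 S)] {k : ℕ}
    {C : Type (max u v)} [CommRing C] [Algebra K C] {ε : C →ₐ[K] K} {η : Deformation S C ε}
    (hη : IsStage S k C ε η) : FiniteDimensional K C ∧ IsLocalRing C := by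
  induction hη with
  | one μ hμ => exact ⟨inferInstance, HarrExt.isLocalRing _⟩
  | succ h μ hμ η' hη' ih =>
    obtain ⟨_, _⟩ := ih
    exact ⟨nextBase_finiteDimensional _ _, nextBase_isLocalRing _ _⟩

/-- The induction only uses that `η_{k+1}` pushes out to `η_k`, so the choices made at earlier
stages are irrelevant. -/
theorem IsStage.differentialSurjective [FiniteDimensional K (HY2 S)] {k : ℕ}
    {C : Type (max u v)} [CommRing C] [Algebra K C] {ε : C →ₐ[K] K} {η : Deformation S C ε}
    (hη : IsStage S k C ε η) : DifferentialSurjective η := by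
  induction hη with
  | one μ hμ => exact differentialSurjective_universalInfinitesimal μ hμ
  | succ h μ hμ η' hη' ih => exact DifferentialSurjective.of_pushout _ (hη'.symm ▸ ih)

end Stages

end DialgDef

theorem mainTheorem9 {K : Type u} {D : Type v} [Field K] [CharZero K] [AddCommGroup D] [Module K D]
    (S : Dialgebra K D) [FiniteDimensional K (HY2 S)]
    (k : ℕ) (C : Type (max u v)) [CommRing C] [Algebra K C] (ε : C →ₐ[K] K)
    (η : Deformation S C ε) (hη : IsStage S k C ε η)
    (μ : HarrH2 ε →ₗ[K] harrZ2 ε K) (hμ : ∀ α, HarrH2.mk ε (μ α) = α) :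
    (FiniteDimensional K (NextBase η μ) ∧ IsLocalRing (NextBase η μ)) ∧
    (Function.Injective (nextIncl η μ) ∧ Function.Exact (nextIncl η μ) (nextProj η μ) ∧
      Function.Surjective (nextProj η μ)) ∧
    (∃ η' : Deformation S (NextBase η μ) (nextAug η μ),
      η'.pushout (nextProj η μ) (fun _ => rfl) = η) ∧
    (∀ η' η'' : Deformation S (NextBase η μ) (nextAug η μ),
      η'.pushout (nextProj η μ) (fun _ => rfl) = η →
      η''.pushout (nextProj η μ) (fun _ => rfl) = η →
      ∃ (r : NextBase η μ ≃ₐ[K] NextBase η μ) (hr : ∀ c, nextProj η μ (r c) = nextProj η μ c),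
        (∀ ψ, r (nextIncl η μ ψ) = nextIncl η μ ψ) ∧
        (η'.pushout r.toAlgHom
          (fun c => congrArg ε (hr c))).Equivalent η'') := by
  obtain ⟨_, _⟩ := hη.finiteDimensional_and_isLocalRing
  refine ⟨⟨nextBase_finiteDimensional η μ, nextBase_isLocalRing η μ⟩,
    ⟨nextIncl_injective η μ, nextIncl_exact η μ, nextProj_surjective η μ⟩,
    exists_next_deformation η μ hμ, fun η' η'' h' h'' => ?_⟩
  obtain ⟨r, hr, hr', hequiv⟩ :=
    (nextExtension η μ).exists_aut_equivalent hη.differentialSurjective h' h''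
  -- The automorphism fixes the kernel of `p_{k+1}` pointwise, and the image of `i_{k+1}` lies in
  -- it.
  exact ⟨r, hr, fun ψ => hr' _ (nextProj_nextIncl η μ ψ), hequiv⟩
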